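/- Let $n\ge 0$ and let $H_{\mathbb Z}=\mathbb Z^{2n}$ with basis $e_1,\dots,e_{2n}$ carry the symplectic form $Q$ with $Q(e_{n+j},e_j)=1=-Q(e_j,e_{n+j})$ for $1\le j\le n$ and $Q(e_i,e_j)=0$ for all other pairs. Write $G_A=\mathrm{Aut}(H_A,Q)$ and $\mathfrak g$ for the Lie algebra of $G_{\mathbb R}$. Let $\{h^{p,-p-1}\}_{p\in\mathbb Z}$ be Hodge numbers of weight $-1$ (non-negative integers, $h^{p,-p-1}=h^{-p-1,p}$, with sum $2n$), let $D$ be the period domain of Hodge structures of weight $-1$ on $H_{\mathbb Z}$ with these Hodge numbers that are polarized by $Q$ (so $i^{p-q}Q(v,\bar v)>0$ for $0\ne v\in H^{p,q}$), and let $\check D$ be its compact dual. A *nilpotent cone* is a cone $\sigma=\sum_j\mathbb R_{\ge0}N_j\subset\mathfrak g$ with finitely many commuting nilpotent $N_j\in\mathfrak g_{\mathbb Q}$. A *$\sigma$-nilpotent orbit* is given by $F\in\check D$ with $\exp(\sum_j ix_jN_j)F\in D$ for $x_j\gg0$ and $NF^p\subset F^{p-1}$ for $N\in\sigma$. It is *of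 even type* if $N^2=0$ for all $N\in\sigma$ and $I^{p,-p}=0$ for all odd $p$, where $H_{\mathbb C}=\bigoplus I^{p,q}$ is the Deligne decomposition of $(W,F)$ and $W$ is the monodromy weight filtration, centered at $-1$, of the elements of the relative interior of $\sigma$. The cone $\sigma$ is *of even type* if it has a nilpotent orbit and all its nilpotent orbits are of even type. A *fan* is a nonempty set of strongly convex nilpotent cones that is closed under taking faces and in which the intersection of any two cones is a face of both; an *even-type fan* is a fan all of whose cones are of even type. Suppose $h^{0,-1}\ge2$ (hence $n\ge2$) and put $S=\mathrm{span}_{\mathbb R}\{e_{2n-1},e_{2n}\}$, $\eta(S)=\{N\in\mathfrak g: \mathrm{Im}\,N\subset S\}$ and $\eta^+(S)=\{N\in\eta(S): \phi_N=Q(\cdot,N\cdot)>0\text{ on }H_{\mathbb R}/S^\perp\}$. Then sending $N$ to the Gram matrix of $\phi_N$ in the basis $e_{n-1},e_n$ of $H_{\mathbb R}/S^\perp$ identifies $\eta(S)$ with $\mathrm{Sym}(2,\mathbb R)$ and $\eta^+(S)$ with the cone of positive definite matrices. Let $$\sigma_0=\mathbb R_{\ge0}\begin{pmatrix}1&0\\0&0\end{pmatrix}+\mathbb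 R_{\ge0}\begin{pmatrix}0&0\\0&1\end{pmatrix}+\mathbb R_{\ge0}\begin{pmatrix}1&-1\\-1&1\end{pmatrix}\subset\mathrm{Sym}(2,\mathbb R)\cong\eta(S).$$ For a subgroup $\Gamma\subset G_{\mathbb Z}$ let $\Gamma(S)=\{\gamma\in\Gamma:\gamma S=S\}$, let $\Gamma$ act by $N\mapsto\gamma N\gamma^{-1}$, and put $\Sigma(S)=\Gamma(S)\cdot\{\text{faces of }\sigma_0\}$. Then, for every subgroup $\Gamma\subset G_{\mathbb Z}$ (in particular for every arithmetic one), $\Sigma(S)$ and $\Gamma\cdot\Sigma(S)$ are even-type fans. Moreover, for $\Gamma=G_{\mathbb Z}$, $\Sigma(S)$ is a $\Gamma(S)$-admissible polyhedral decomposition of $\eta^+(S)$: it is a $\Gamma(S)$-stable fan of cones contained in the closure of $\eta^+(S)$, it consists of finitely many $\Gamma(S)$-orbits, and $\eta^+(S)=\bigcup_{\sigma\in\Sigma(S)}(\sigma\cap\eta^+(S))$. -/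

import Mathlib

open scoped Matrix

namespace EvenFan

/-! ### The symplectic space -/

/-- `H_A = A^{2n}` with its standard basis `e_1, …, e_{2n}`; here `Sum.inl j` is the index of `e_j`
and `Sum.inr j` the index of `e_{n+j}`. -/
abbrev H (n : ℕ) (A : Type) : Type := Fin n ⊕ Fin n → A

/-- `2n × 2n` matrices, i.e. endomorphisms of `H_A`. -/
abbrev Mat (n : ℕ) (A : Type) : Type := Matrix (Fin n ⊕ Fin n) (Fin n ⊕ Fin n) A

/-- The symplectic form on `H_A`, `Q(v, w) = ᵗv J w` with `J = (0, -1; 1, 0)`, so that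
`Q(e_{n+j}, e_j) = 1 = -Q(e_j, e_{n+j})` and all other pairs of basis vectors are orthogonal. -/
def Q {n : ℕ} {A : Type} [CommRing A] (v w : H n A) : A := v ⬝ᵥ (Matrix.J (Fin n) A *ᵥ w)

/-- The Lie algebra `𝔤_A = {X | Q(Xv, w) + Q(v, Xw) = 0}` of `G_A = Sp(n, A)`. -/
abbrev g (n : ℕ) (A : Type) [CommRing A] : Set (Mat n A) :=
  (LieAlgebra.Symplectic.sp (Fin n) A : Set (Mat n A))

/-- The arithmetic group `G_ℤ = Sp(n, ℤ)` (matrices of size `2n`). -/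
abbrev GZ (n : ℕ) : Type := Matrix.symplecticGroup (Fin n) ℤ

/-- The real matrix of `γ ∈ G_ℤ`. -/
noncomputable def toReal {n : ℕ} (γ : GZ n) : Mat n ℝ := (γ : Mat n ℤ).map (Int.castRingHom ℝ)

/-- The adjoint action of `γ ∈ G_ℤ` on real matrices, `N ↦ γ N γ⁻¹`. -/
noncomputable def Ad {n : ℕ} (γ : GZ n) : Mat n ℝ →ₗ[ℝ] Mat n ℝ :=
  LinearMap.mulLeftRight ℝ (toReal γ, toReal γ⁻¹)

theorem Ad_apply {n : ℕ} (γ : GZ n) (N : Mat n ℝ) :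
    Ad γ N = toReal γ * N * toReal γ⁻¹ := by
  simp [Ad, LinearMap.mulLeftRight_apply]

/-- The complexification of a real endomorphism. -/
noncomputable def toComplex {n : ℕ} (N : Mat n ℝ) : Mat n ℂ := N.map (algebraMap ℝ ℂ)

/-! ### Cones and fans -/

/-- Real cones in the space of endomorphisms of `H_ℝ`. -/
abbrev Cone (n : ℕ) : Type := PointedCone ℝ (Mat n ℝ)

/-- The translate `Ad(γ) σ` of a cone. -/
noncomputable def Cone.translate {n : ℕ} (γ : GZ n) (σ : Cone n) : Cone n := PointedCone.map (Ad γ) σ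

/-- `N_1, …, N_ℓ` are mutually commuting nilpotent elements of `𝔤_ℚ` that generate `σ`,
`σ = ∑ ℝ_{≥ 0} N_j`. -/
structure IsGenerating {n ℓ : ℕ} (N : Fin ℓ → Mat n ℚ) (σ : Cone n) : Prop where
  mem_g : ∀ j, N j ∈ g n ℚ
  nilpotent : ∀ j, IsNilpotent (N j)
  commute : ∀ j k, Commute (N j) (N k)
  span_eq : Submodule.span {c : ℝ // 0 ≤ c}
    (Set.range fun j => (N j).map (algebraMap ℚ ℝ)) = σ

/-- A (finitely generated rational polyhedral) nilpotent cone. -/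
def IsNilpotentCone {n : ℕ} (σ : Cone n) : Prop :=
  ∃ (ℓ : ℕ) (N : Fin ℓ → Mat n ℚ), IsGenerating N σ

/-- A fan of nilpotent cones: a nonempty set of strongly convex rational nilpotent cones which is
closed under passing to faces and in which any two cones meet in a common face. -/
structure IsFan {n : ℕ} (Sig : Set (Cone n)) : Prop where
  nonempty : Sig.Nonempty
  nilpotent : ∀ σ ∈ Sig, IsNilpotentCone σ
  salient : ∀ σ ∈ Sig, (PointedCone.toConvexCone σ).Salient
  face_mem : ∀ σ ∈ Sig, ∀ τ : Cone n, PointedCone.IsFaceOf τ σ → τ ∈ Sig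
  inter_face : ∀ σ ∈ Sig, ∀ τ ∈ Sig, PointedCone.IsFaceOf (σ ⊓ τ) σ

/-! ### Period domains -/

/-- Hodge numbers `p ↦ h^{p,-p-1}` of weight `-1` and total dimension `2n`. -/
structure HodgeNumbers (n : ℕ) where
  /-- `h p` is the number `h^{p,-p-1}`. -/
  h : ℤ →₀ ℕ
  symm : ∀ p, h (-p - 1) = h p
  total : (h.sum fun _ m => m) = 2 * n

/-- `h^{0,-1} ≤ n`. -/
theorem HodgeNumbers.h_zero_le {n : ℕ} (h : HodgeNumbers n) : h.h 0 ≤ n := by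
  have h1 : h.h (-1) = h.h 0 := by simpa using h.symm 0
  have h2 : ∑ p ∈ ({0, -1} : Finset ℤ), h.h p ≤ 2 * n := by
    rw [← h.total, Finsupp.sum]
    apply Finset.sum_le_sum_of_ne_zero
    intro p _ hp
    simpa using hp
  rw [Finset.sum_pair (by decide), h1] at h2
  omega

/-- Families of complex subspaces `F^p` of `H_ℂ`. -/
abbrev Filt (n : ℕ) : Type := ℤ → Submodule ℂ (H n ℂ)

/-- The complex conjugate of a complex subspace of `H_ℂ`. -/
def conj {n : ℕ} (V : Submodule ℂ (H n ℂ)) : Submodule ℂ (H n ℂ) where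
  carrier := {v | star v ∈ V}
  add_mem' {a b} ha hb := by
    have : star a + star b ∈ V := V.add_mem ha hb
    simpa using this
  zero_mem' := by simp
  smul_mem' c a ha := by
    have : star c • star a ∈ V := V.smul_mem _ ha
    simpa [star_smul] using this

/-- The image `A F` of a filtration under an endomorphism. -/
def Filt.map {n : ℕ} (A : Mat n ℂ) (F : Filt n) : Filt n :=
  fun p => (F p).map (Matrix.toLin' A)

/-- The compact dual `Ď`: decreasing filtrations `F` of `H_ℂ` with
`dim F^p = ∑_{r ≥ p} h^{r,-r-1}` and `Q(F^p, F^{-p}) = 0`. -/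
structure CompactDual {n : ℕ} (h : HodgeNumbers n) (F : Filt n) : Prop where
  antitone : Antitone F
  finrank_eq : ∀ p, Module.finrank ℂ (F p) = ∑ r ∈ h.h.support with p ≤ r, h.h r
  isotropic : ∀ p, ∀ v ∈ F p, ∀ w ∈ F (-p), Q v w = 0

/-- The period domain `D`: points of `Ď` that are Hodge structures of weight `-1`, i.e.
`H_ℂ = F^p ⊕ conj F^{-p}` for all `p`, polarized by `Q`, i.e. `i^{p-q} Q(v, conj v) > 0` for
`0 ≠ v ∈ H^{p,q} = F^p ∩ conj F^q`, `q = -p-1`.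
(The number `i^{2p+1} Q(v, conj v)` is automatically real.) -/
structure PeriodDomain {n : ℕ} (h : HodgeNumbers n) (F : Filt n) : Prop where
  compactDual : CompactDual h F
  opposed : ∀ p, IsCompl (F p) (conj (F (-p)))
  positive : ∀ p, ∀ v ∈ F p ⊓ conj (F (-p - 1)), v ≠ 0 →
    0 < (Complex.I ^ (2 * p + 1) * Q v (star v)).re

/-! ### Nilpotent orbits, limiting mixed Hodge structures, even type -/

/-- `(σ, exp(σ_ℂ) F)` is a nilpotent orbit: `σ = ∑ ℝ_{≥ 0} N_j` is a nilpotent cone, `F ∈ Ď`,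
`exp(∑ i x_j N_j) F ∈ D` for `x_j ≫ 0`, and `N F^p ⊆ F^{p-1}` for `N ∈ σ`.
(The condition does not depend on the choice of the generators.) -/
structure IsNilpotentOrbit {n : ℕ} (h : HodgeNumbers n) (σ : Cone n) (F : Filt n) : Prop where
  compactDual : CompactDual h F
  mem_periodDomain : ∃ (ℓ : ℕ) (N : Fin ℓ → Mat n ℚ), IsGenerating N σ ∧
    ∃ R : ℝ, ∀ x : Fin ℓ → ℝ, (∀ j, R < x j) →
      PeriodDomain h (F.map (NormedSpace.exp
        (∑ j, (Complex.I * (x j : ℂ)) • (N j).map (algebraMap ℚ ℂ))))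
  transversal : ∀ N ∈ σ, ∀ p, ∀ v ∈ F p, toComplex N *ᵥ v ∈ F (p - 1)

/-- `W` is the monodromy weight filtration of the endomorphism `N`, centered at `-1`: a finite
increasing filtration with `N W_k ⊆ W_{k-2}` for which `N^m` induces an isomorphism
`gr^W_{-1+m} ≅ gr^W_{-1-m}` for all `m ≥ 0`. -/
structure IsWeightFiltration {n : ℕ} (N : Mat n ℂ) (W : Filt n) : Prop where
  monotone : Monotone W
  exists_bot : ∃ k, W k = ⊥
  exists_top : ∃ k, W k = ⊤
  shift : ∀ k, ∀ v ∈ W k, N *ᵥ v ∈ W (k - 2)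
  gr_injective : ∀ m : ℕ, ∀ v ∈ W (-1 + m), (N ^ m) *ᵥ v ∈ W (-2 - m) → v ∈ W (-2 + m)
  gr_surjective : ∀ m : ℕ, ∀ w ∈ W (-1 - m), ∃ v ∈ W (-1 + m), w - (N ^ m) *ᵥ v ∈ W (-2 - m)

/-- The summand `I^{p,q}` of the Deligne decomposition of `(W, F)`:
`I^{p,q} = F^p ∩ W_{p+q} ∩ (conj F^q ∩ W_{p+q} + ∑_{j ≥ 1} conj F^{q-j} ∩ W_{p+q-j-1})`. -/
def deligne {n : ℕ} (W F : Filt n) (p q : ℤ) : Submodule ℂ (H n ℂ) :=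
  F p ⊓ W (p + q) ⊓
    (conj (F q) ⊓ W (p + q) ⊔
      ⨆ (j : ℕ) (_ : 1 ≤ j), conj (F (q - j)) ⊓ W (p + q - j - 1))

/-- A nilpotent orbit `(σ, exp(σ_ℂ) F)` is of even type if `N² = 0` for all `N ∈ σ` and, for the
weight filtration `W = W(σ)` (the common monodromy weight filtration of all `N` in the relative
interior of `σ`), the Deligne decomposition of `(W, F)` has `I^{p,-p} = 0` for all odd `p`. -/
structure IsEvenTypeOrbit {n : ℕ} (σ : Cone n) (F : Filt n) : Prop where
  sq_eq_zero : ∀ N ∈ σ, N * N = 0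
  deligne_eq_bot : ∃ W : Filt n,
    (∀ N ∈ intrinsicInterior ℝ (σ : Set (Mat n ℝ)), IsWeightFiltration (toComplex N) W) ∧
    ∀ p : ℤ, Odd p → deligne W F p (-p) = ⊥

/-- A nilpotent cone is of even type if it generates a nilpotent orbit and all its nilpotent orbits
are of even type. -/
structure IsEvenTypeCone {n : ℕ} (h : HodgeNumbers n) (σ : Cone n) : Prop where
  nilpotent : IsNilpotentCone σ
  exists_orbit : ∃ F, IsNilpotentOrbit h σ F
  even_orbit : ∀ F, IsNilpotentOrbit h σ F → IsEvenTypeOrbit σ F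

/-- An even-type fan: a fan all of whose cones are of even type. -/
structure IsEvenTypeFan {n : ℕ} (h : HodgeNumbers n) (Sig : Set (Cone n)) : Prop where
  isFan : IsFan Sig
  evenType : ∀ σ ∈ Sig, IsEvenTypeCone h σ

/-! ### Admissible polyhedral decompositions -/

/-- `η(S) = {N ∈ 𝔤 | Im N ⊆ S}`. -/
def eta {n : ℕ} (S : Submodule ℝ (H n ℝ)) : Set (Mat n ℝ) :=
  {N | N ∈ g n ℝ ∧ ∀ v, N *ᵥ v ∈ S}

/-- `η⁺(S)`: those `N ∈ η(S)` for which the form `φ_N(v, w) = Q(v, N w)` is positive definite on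
`H_ℝ / S^⊥`. -/
def etaPos {n : ℕ} (S : Submodule ℝ (H n ℝ)) : Set (Mat n ℝ) :=
  {N | N ∈ eta S ∧ ∀ v, ¬ (∀ s ∈ S, Q s v = 0) → 0 < Q v (N *ᵥ v)}

theorem toReal_one {n : ℕ} : toReal (1 : GZ n) = 1 := by
  simp [toReal]

theorem toReal_mul {n : ℕ} (γ δ : GZ n) : toReal (γ * δ) = toReal γ * toReal δ := by
  simp only [toReal, Submonoid.coe_mul, Matrix.map_mul]

/-- `Γ(S)`, the subgroup of all `γ ∈ Γ` with `γ S = S`. -/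
def stab {n : ℕ} (Γ : Subgroup (GZ n)) (S : Submodule ℝ (H n ℝ)) : Subgroup (GZ n) where
  carrier := {γ | γ ∈ Γ ∧ S.map (Matrix.toLin' (toReal γ)) = S}
  mul_mem' {γ δ} hγ hδ := by
    refine ⟨Γ.mul_mem hγ.1 hδ.1, ?_⟩
    rw [toReal_mul, Matrix.toLin'_mul, Submodule.map_comp, hδ.2, hγ.2]
  one_mem' := ⟨Γ.one_mem, by rw [toReal_one, Matrix.toLin'_one, Submodule.map_id]⟩
  inv_mem' {γ} hγ := by
    refine ⟨Γ.inv_mem hγ.1, ?_⟩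
    conv_lhs => rw [← hγ.2]
    rw [← Submodule.map_comp, ← Matrix.toLin'_mul, ← toReal_mul, inv_mul_cancel, toReal_one,
      Matrix.toLin'_one, Submodule.map_id]

/-- `Sig` is a `Γ(S)`-admissible polyhedral decomposition of `η⁺(S)`. -/
structure IsAdmissibleDecomposition {n : ℕ} (Γ : Subgroup (GZ n)) (S : Submodule ℝ (H n ℝ))
    (Sig : Set (Cone n)) : Prop where
  isFan : IsFan Sig
  subset_closure : ∀ σ ∈ Sig, (σ : Set (Mat n ℝ)) ⊆ closure (etaPos S)
  translate_mem : ∀ σ ∈ Sig, ∀ γ ∈ stab Γ S, σ.translate γ ∈ Sig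
  finite_orbits : ∃ T : Set (Cone n), T.Finite ∧ T ⊆ Sig ∧
    ∀ σ ∈ Sig, ∃ γ ∈ stab Γ S, σ.translate γ ∈ T
  covers : etaPos S = ⋃ σ ∈ Sig, (σ : Set (Mat n ℝ)) ∩ etaPos S

/-! ### The decomposition for the isotropic plane `S = span{e_{2n-1}, e_{2n}}` -/

/-- The two last indices of `Fin n` (numbers `n-1` and `n` when counted from `1`). -/
def idx {n : ℕ} (hn : 2 ≤ n) (a : Fin 2) : Fin n := ⟨n - 2 + a, by omega⟩

/-- `S = span{e_{2n-1}, e_{2n}}`. -/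
def plane {n : ℕ} (hn : 2 ≤ n) : Submodule ℝ (H n ℝ) :=
  Submodule.span ℝ (Set.range fun a => Pi.single (Sum.inr (idx hn a)) (1 : ℝ))

/-- The `n × 2` matrix whose columns are the two last standard basis vectors. -/
def incl {n : ℕ} (hn : 2 ≤ n) : Matrix (Fin n) (Fin 2) ℝ :=
  Matrix.of fun i a => if i = idx hn a then 1 else 0

/-- The identification `Sym(2, ℝ) ≅ η(S)`: `X` corresponds to the endomorphism `N` for which `X` is
the Gram matrix of `φ_N` with respect to the basis `e_{n-1}, e_n` of `H_ℝ / S^⊥`. -/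
def symEquiv {n : ℕ} (hn : 2 ≤ n) (X : Matrix (Fin 2) (Fin 2) ℝ) : Mat n ℝ :=
  Matrix.fromBlocks 0 0 (-(incl hn * X * (incl hn)ᵀ)) 0

theorem Q_symEquiv {n : ℕ} (hn : 2 ≤ n) (X : Matrix (Fin 2) (Fin 2) ℝ) (a b : Fin 2) :
    Q (Pi.single (Sum.inl (idx hn a)) 1)
      (symEquiv hn X *ᵥ Pi.single (Sum.inl (idx hn b)) 1) = X a b := by
  have hinj : ∀ c d : Fin 2, idx hn c = idx hn d ↔ c = d := by
    intro c d
    simp only [idx, Fin.ext_iff]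
    omega
  rw [Q, Matrix.mulVec_mulVec, symEquiv, Matrix.J, Matrix.fromBlocks_multiply,
    Matrix.mulVec_single_one, single_one_dotProduct]
  simp [incl, Matrix.mul_apply, hinj]

/-- `σ₀ = ℝ_{≥0} (1 0; 0 0) + ℝ_{≥0} (0 0; 0 1) + ℝ_{≥0} (1 -1; -1 1)`. -/
def sigmaZero {n : ℕ} (hn : 2 ≤ n) : Cone n :=
  Submodule.span {c : ℝ // 0 ≤ c}
    {symEquiv hn !![1, 0; 0, 0], symEquiv hn !![0, 0; 0, 1], symEquiv hn !![1, -1; -1, 1]}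

/-- `Σ(S) = Γ(S) {faces of σ₀}`. -/
def SigmaS {n : ℕ} (hn : 2 ≤ n) (Γ : Subgroup (GZ n)) : Set (Cone n) :=
  {σ | ∃ γ ∈ stab Γ (plane hn), ∃ τ : Cone n,
    PointedCone.IsFaceOf τ (sigmaZero hn) ∧ σ = τ.translate γ}

/-- `Γ Sig = {Ad(γ) σ | γ ∈ Γ, σ ∈ Sig}`. -/
def translates {n : ℕ} (Γ : Subgroup (GZ n)) (Sig : Set (Cone n)) : Set (Cone n) :=
  {σ | ∃ γ ∈ Γ, ∃ τ ∈ Sig, σ = τ.translate γ}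

end EvenFan

/-! The cone `σ₀` is generated by the rank one endomorphisms `u ↦ Q(u, w) w`, where `w` runs through
three integral vectors of the isotropic plane `S`. Their coordinates are, up to sign, the minimal
vectors of the form `x² + xy + y²`. For an element `N` of `σ₀` or of a translate, `φ_N` is a sum of
squares with nonnegative weights, so every positivity argument reduces to vanishing of squares.

Fan property. Suppose `N` lies in `σ₀` with weights `a` and in `γ σ₀` with weights `b`. Testing
`φ_N` on `S^⊥` shows that each translated generator occurring in `N` is an integral vector of `S`.
The linear functional `hexTrace` takes the value `x² + xy + y²` on the rank one element of `(x, y)`: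
it is `1` on the generators and at least `1` on nonzero integral vectors. Hence `∑ b ≤ ∑ a`, and the
same argument for `γ⁻¹` gives equality, so every generator that occurs is common to both cones up to
sign (`sum_le_of_sum_eq`, `inf_translate_isFaceOf`). This works for every `γ ∈ G_ℤ`, so no condition
on the group is needed.

Covering. A basis of `ℤ²` minimizing `X(r, r) + X(s, s) + X(r, s)` forms an obtuse superbase
together with `-r-s` (Selling reduction). In the dual coordinates `X` is a nonnegative combination
of the three generators (`exists_reduction`).

Even type. Elements of `σ₀` square to zero and have `φ_N ≥ 0`, so the weight filtration is `0 ⊆ Im N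
⊆ Ker N ⊆ H`. For `v ∈ I^{p,-p}` with `p` odd, `exp(iyN) v` has Hodge type `(p, -p-1)`; the
polarization then makes a constant minus `2y φ_N(v, conj v)` positive for all large `y`. This forces
`N v = 0`, after which the constant vanishes too, so `v = 0` (`eq_zero_of_odd`).

Existence of orbits. Since `h^{0,-1} ≥ 2`, there is an explicit Hodge structure in which the last
two coordinates have degree zero. Applying `exp(iN)` to it only replaces its positive definite
matrix `1` by `1 + Y` with `Y ≥ 0`, and the result stays in `D` (`IsShear.map_hodgeFilt`).
Everything is then transported along `G_ℤ`. -/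

namespace EvenFan

/-! ### Elementary properties of the symplectic form -/

section Form

variable {n : ℕ} {A : Type} [CommRing A]

theorem Q_apply (v w : H n A) :
    Q v w = (v ∘ Sum.inr) ⬝ᵥ (w ∘ Sum.inl) - (v ∘ Sum.inl) ⬝ᵥ (w ∘ Sum.inr) := by
  rw [Q, Matrix.J, Matrix.fromBlocks_mulVec]
  conv_lhs => rw [← Sum.elim_comp_inl_inr v]
  rw [sumElim_dotProduct_sumElim]
  simp [Matrix.neg_mulVec]
  ring

@[simp] theorem Q_add_left (u v w : H n A) : Q (u + v) w = Q u w + Q v w := by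
  simp [Q, add_dotProduct]

@[simp] theorem Q_add_right (u v w : H n A) : Q u (v + w) = Q u v + Q u w := by
  simp [Q, Matrix.mulVec_add, dotProduct_add]

@[simp] theorem Q_smul_left (c : A) (v w : H n A) : Q (c • v) w = c * Q v w := by
  simp [Q, smul_dotProduct]

@[simp] theorem Q_smul_right (c : A) (v w : H n A) : Q v (c • w) = c * Q v w := by
  simp [Q, Matrix.mulVec_smul, dotProduct_smul]

@[simp] theorem Q_zero_left (w : H n A) : Q 0 w = 0 := by simp [Q]

@[simp] theorem Q_zero_right (w : H n A) : Q w 0 = 0 := by simp [Q]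

theorem Q_swap (v w : H n A) : Q v w = -Q w v := by
  rw [Q_apply, Q_apply, dotProduct_comm (v ∘ Sum.inr), dotProduct_comm (v ∘ Sum.inl)]
  ring

theorem Q_sum_right {ι : Type*} (s : Finset ι) (v : H n A) (w : ι → H n A) :
    Q v (∑ i ∈ s, w i) = ∑ i ∈ s, Q v (w i) := by
  simp [Q, Matrix.mulVec_sum, dotProduct_sum]

theorem mem_g_iff {N : Mat n A} :
    N ∈ g n A ↔ Nᵀ * Matrix.J (Fin n) A = Matrix.J (Fin n) A * -N := by
  change N ∈ LieAlgebra.Symplectic.sp (Fin n) A ↔ _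
  rw [LieAlgebra.Symplectic.sp, mem_skewAdjointMatricesLieSubalgebra,
    mem_skewAdjointMatricesSubmodule]
  rfl

theorem Q_mulVec_left {N : Mat n A} (hN : N ∈ g n A) (v w : H n A) :
    Q (N *ᵥ v) w = -Q v (N *ᵥ w) := by
  have h := mem_g_iff.1 hN
  rw [Q, Q, ← Matrix.vecMul_transpose, ← Matrix.dotProduct_mulVec, Matrix.mulVec_mulVec, h,
    ← Matrix.mulVec_mulVec, Matrix.neg_mulVec, Matrix.mulVec_neg, dotProduct_neg]

theorem Q_mulVec_mulVec {M : Mat n A} (hM : M ∈ Matrix.symplecticGroup (Fin n) A) (v w : H n A) :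
    Q (M *ᵥ v) (M *ᵥ w) = Q v w := by
  have h := SymplecticGroup.mem_iff'.1 hM
  rw [Q, Q, ← Matrix.vecMul_transpose, ← Matrix.dotProduct_mulVec, Matrix.mulVec_mulVec,
    Matrix.mulVec_mulVec, h]

theorem mem_g_of_Q {N : Mat n A} (hN : ∀ v w, Q (N *ᵥ v) w = -Q v (N *ᵥ w)) : N ∈ g n A := by
  rw [mem_g_iff]
  ext i j
  have h := hN (Pi.single i 1) (Pi.single j 1)
  rw [Q, Q, ← Matrix.vecMul_transpose, ← Matrix.dotProduct_mulVec, Matrix.mulVec_mulVec,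
    Matrix.mulVec_mulVec] at h
  simpa [Matrix.mul_neg] using h

theorem map_mem_g {B : Type} [CommRing B] (f : A →+* B) {N : Mat n A} (hN : N ∈ g n A) :
    N.map f ∈ g n B := by
  have h := congrArg (fun M : Mat n A => M.map f) (mem_g_iff.1 hN)
  rw [mem_g_iff]
  simp only [Matrix.map_mul, Matrix.map_J] at h
  rw [← Matrix.transpose_map, h, Matrix.map_neg]
  exact map_neg f

/-- The endomorphism `u ↦ Q(u, w) w`. -/
def rankOne (w : H n A) : Mat n A := Matrix.vecMulVec w (Matrix.J (Fin n) A *ᵥ w)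

theorem rankOne_mulVec (w u : H n A) : rankOne w *ᵥ u = Q u w • w := by
  rw [rankOne, Matrix.vecMulVec_mulVec, Q, dotProduct_comm]
  simp

theorem rankOne_mem_g (w : H n A) : rankOne w ∈ g n A := by
  refine mem_g_of_Q fun u v => ?_
  rw [rankOne_mulVec, rankOne_mulVec, Q_smul_left, Q_smul_right, Q_swap w v]
  ring

theorem rankOne_neg (w : H n A) : rankOne (-w) = rankOne w := by
  simp [rankOne, Matrix.mulVec_neg, Matrix.neg_vecMulVec, Matrix.vecMulVec_neg]

theorem mat_ext {M N : Mat n A} (h : ∀ v, M *ᵥ v = N *ᵥ v) : M = N :=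
  Matrix.ext_of_mulVec_single fun _ => h _

theorem rankOne_mul_rankOne (v w : H n A) (h : Q w v = 0) : rankOne v * rankOne w = 0 := by
  refine mat_ext fun u => ?_
  rw [← Matrix.mulVec_mulVec, rankOne_mulVec, rankOne_mulVec]
  simp [h]

theorem rankOne_map {B : Type} [CommRing B] (f : A →+* B) (w : H n A) :
    (rankOne w).map f = rankOne (f ∘ w) := by
  rw [rankOne, rankOne]
  ext i j
  have : Matrix.J (Fin n) B *ᵥ (f ∘ w) = f ∘ (Matrix.J (Fin n) A *ᵥ w) := by
    rw [← Matrix.map_J (l := Fin n) f]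
    ext i
    simp [RingHom.map_mulVec]
  simp [Matrix.vecMulVec_apply, this]

end Form

/-! ### The action of the arithmetic group -/

section Action

variable {n : ℕ}

/-- The matrix of `γ ∈ G_ℤ` over a commutative ring. -/
def cast (A : Type) [CommRing A] (γ : GZ n) : Mat n A := (γ : Mat n ℤ).map (Int.castRingHom A)

variable {A : Type} [CommRing A]

theorem cast_mul (γ δ : GZ n) : cast A (γ * δ) = cast A γ * cast A δ := by
  simp only [cast, Submonoid.coe_mul, Matrix.map_mul]

theorem cast_one : cast A (1 : GZ n) = 1 := by simp [cast]

@[simp] theorem cast_mul_inv (γ : GZ n) : cast A γ * cast A γ⁻¹ = 1 := by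
  rw [← cast_mul, mul_inv_cancel, cast_one]

@[simp] theorem cast_inv_mul (γ : GZ n) : cast A γ⁻¹ * cast A γ = 1 := by
  rw [← cast_mul, inv_mul_cancel, cast_one]

@[simp] theorem cast_mulVec_inv (γ : GZ n) (v : H n A) : cast A γ *ᵥ (cast A γ⁻¹ *ᵥ v) = v := by
  simp [Matrix.mulVec_mulVec]

@[simp] theorem cast_inv_mulVec (γ : GZ n) (v : H n A) : cast A γ⁻¹ *ᵥ (cast A γ *ᵥ v) = v := by
  simp [Matrix.mulVec_mulVec]

theorem cast_mem (γ : GZ n) : cast A γ ∈ Matrix.symplecticGroup (Fin n) A :=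
  SymplecticGroup.map_mem γ.2 _

theorem cast_map {B : Type} [CommRing B] (f : A →+* B) (γ : GZ n) :
    (cast A γ).map f = cast B γ := by
  ext i j
  simp [cast]

theorem Q_cast_mulVec (γ : GZ n) (v w : H n A) : Q (cast A γ *ᵥ v) w = Q v (cast A γ⁻¹ *ᵥ w) := by
  rw [← Q_mulVec_mulVec (cast_mem γ) v, cast_mulVec_inv]

theorem conj_rankOne (γ : GZ n) (w : H n A) :
    cast A γ * rankOne w * cast A γ⁻¹ = rankOne (cast A γ *ᵥ w) := by
  refine mat_ext fun u => ?_
  rw [← Matrix.mulVec_mulVec, ← Matrix.mulVec_mulVec, rankOne_mulVec, rankOne_mulVec,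
    Matrix.mulVec_smul, Q_swap u, Q_cast_mulVec, ← Q_swap, inv_inv]

theorem conj_mem_g (γ : GZ n) {N : Mat n A} (hN : N ∈ g n A) :
    cast A γ * N * cast A γ⁻¹ ∈ g n A := by
  refine mem_g_of_Q fun v w => ?_
  simp only [← Matrix.mulVec_mulVec]
  rw [Q_cast_mulVec, Q_mulVec_left hN, ← Q_mulVec_mulVec (cast_mem γ), cast_mulVec_inv]

/-- `toReal γ` is `cast ℝ γ` by definition; from here on only the version over arbitrary rings is
used. -/
theorem Ad_eq (γ : GZ n) (N : Mat n ℝ) : Ad γ N = cast ℝ γ * N * cast ℝ γ⁻¹ := Ad_apply γ N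

theorem Ad_mul (γ δ : GZ n) : Ad (γ * δ) = Ad γ ∘ₗ Ad δ := by
  ext1 N
  simp only [LinearMap.comp_apply, Ad_eq, mul_inv_rev, cast_mul, Matrix.mul_assoc]

theorem Ad_one : Ad (1 : GZ n) = LinearMap.id := by
  ext1 N
  simp [Ad_eq, cast_one]

theorem Ad_inv_apply (γ : GZ n) (N : Mat n ℝ) : Ad γ⁻¹ (Ad γ N) = N := by
  rw [← LinearMap.comp_apply, ← Ad_mul, inv_mul_cancel, Ad_one, LinearMap.id_apply]

theorem Ad_injective (γ : GZ n) : Function.Injective (Ad γ) :=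
  Function.LeftInverse.injective (Ad_inv_apply γ)

theorem Ad_rankOne (γ : GZ n) (w : H n ℝ) : Ad γ (rankOne w) = rankOne (cast ℝ γ *ᵥ w) := by
  rw [Ad_eq, conj_rankOne]

theorem Ad_mulVec (γ : GZ n) (N : Mat n ℝ) (v : H n ℝ) :
    Ad γ N *ᵥ v = cast ℝ γ *ᵥ (N *ᵥ (cast ℝ γ⁻¹ *ᵥ v)) := by
  simp [Ad_eq, Matrix.mulVec_mulVec, Matrix.mul_assoc]

theorem Q_Ad (γ : GZ n) (N : Mat n ℝ) (v : H n ℝ) :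
    Q v (Ad γ N *ᵥ v) = Q (cast ℝ γ⁻¹ *ᵥ v) (N *ᵥ (cast ℝ γ⁻¹ *ᵥ v)) := by
  rw [Ad_mulVec, Q_cast_mulVec, inv_inv]

theorem translate_mul (γ δ : GZ n) (σ : Cone n) :
    σ.translate (γ * δ) = (σ.translate δ).translate γ := by
  rw [Cone.translate, Cone.translate, Cone.translate, PointedCone.map_map, Ad_mul]

theorem translate_one (σ : Cone n) : σ.translate 1 = σ := by
  rw [Cone.translate, Ad_one, PointedCone.map_id]

theorem translate_inv_translate (γ : GZ n) (σ : Cone n) : (σ.translate γ).translate γ⁻¹ = σ := by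
  rw [← translate_mul, inv_mul_cancel, translate_one]

theorem translate_translate_inv (γ : GZ n) (σ : Cone n) : (σ.translate γ⁻¹).translate γ = σ := by
  rw [← translate_mul, mul_inv_cancel, translate_one]

theorem mem_translate {γ : GZ n} {σ : Cone n} {N : Mat n ℝ} :
    N ∈ σ.translate γ ↔ ∃ M ∈ σ, Ad γ M = N := PointedCone.mem_map

theorem isFaceOf_translate {γ : GZ n} {τ σ : Cone n} :
    PointedCone.IsFaceOf (τ.translate γ) (σ.translate γ) ↔ PointedCone.IsFaceOf τ σ :=
  PointedCone.isFaceOf_map_iff (Ad_injective γ)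

theorem translate_inf (γ : GZ n) (σ τ : Cone n) :
    (σ ⊓ τ).translate γ = σ.translate γ ⊓ τ.translate γ :=
  Submodule.map_inf _ (Ad_injective γ)

theorem IsGenerating.translate {ℓ : ℕ} {N : Fin ℓ → Mat n ℚ} {σ : Cone n} (hN : IsGenerating N σ)
    (γ : GZ n) :
    IsGenerating (fun j => cast ℚ γ * N j * cast ℚ γ⁻¹) (σ.translate γ) where
  mem_g j := conj_mem_g γ (hN.mem_g j)
  nilpotent j := by
    obtain ⟨k, hk⟩ := hN.nilpotent j
    refine ⟨k, ?_⟩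
    let u : (Mat n ℚ)ˣ := ⟨cast ℚ γ, cast ℚ γ⁻¹, cast_mul_inv γ, cast_inv_mul γ⟩
    have := Units.conj_pow u (N j) k
    rw [hk] at this
    simpa [u] using this
  commute j k := by
    have h := (hN.commute j k).eq
    have key : ∀ X Y : Mat n ℚ, cast ℚ γ * X * cast ℚ γ⁻¹ * (cast ℚ γ * Y * cast ℚ γ⁻¹) =
        cast ℚ γ * (X * Y) * cast ℚ γ⁻¹ := by
      intro X Y
      calc _ = cast ℚ γ * X * (cast ℚ γ⁻¹ * cast ℚ γ) * Y * cast ℚ γ⁻¹ := by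
            simp only [Matrix.mul_assoc]
        _ = _ := by simp [Matrix.mul_assoc]
    rw [commute_iff_eq, key, key, h]
  span_eq := by
    rw [Cone.translate, PointedCone.map, ← hN.span_eq, Submodule.map_span, ← Set.range_comp]
    congr 2
    ext1 j
    simp only [Function.comp_apply, LinearMap.coe_restrictScalars, Ad_eq]
    rw [Matrix.map_mul, Matrix.map_mul, cast_map, cast_map]

theorem IsNilpotentCone.translate {σ : Cone n} (hσ : IsNilpotentCone σ) (γ : GZ n) :
    IsNilpotentCone (σ.translate γ) := by
  obtain ⟨ℓ, N, hN⟩ := hσ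
  exact ⟨ℓ, _, hN.translate γ⟩

end Action

/-! ### The identification of `η(S)` with symmetric matrices -/

section Plane

variable {n : ℕ} (hn : 2 ≤ n)

theorem idx_injective : Function.Injective (idx hn) := by
  intro c d
  simp only [idx, Fin.ext_iff]
  omega

/-- The inclusion of the two last coordinates, over any commutative ring. -/
def inclusion (A : Type) [CommRing A] : Matrix (Fin n) (Fin 2) A :=
  Matrix.of fun i a => if i = idx hn a then 1 else 0

theorem incl_eq : incl hn = inclusion hn ℝ := rfl

variable {A : Type} [CommRing A]

@[simp] theorem inclusion_transpose_mul : (inclusion hn A)ᵀ * inclusion hn A = 1 := by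
  ext a b
  simp [inclusion, Matrix.mul_apply, Matrix.one_apply, (idx_injective hn).eq_iff, eq_comm]

@[simp] theorem inclusion_transpose_mulVec (y : Fin 2 → A) :
    (inclusion hn A)ᵀ *ᵥ (inclusion hn A *ᵥ y) = y := by
  simp [Matrix.mulVec_mulVec]

theorem inclusion_map {B : Type} [CommRing B] (f : A →+* B) :
    (inclusion hn A).map f = inclusion hn B := by
  ext i a
  simp [inclusion, apply_ite f]

/-- The element `y_1 e_{2n-1} + y_2 e_{2n}`. -/
def planeVec (y : Fin 2 → A) : H n A := Sum.elim 0 (inclusion hn A *ᵥ y)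

theorem planeVec_zero : planeVec hn (0 : Fin 2 → A) = 0 := by
  ext (i | i) <;> simp [planeVec]

theorem planeVec_neg (y : Fin 2 → A) : planeVec hn (-y) = -planeVec hn y := by
  ext (i | i) <;> simp [planeVec, Matrix.mulVec_neg]

theorem planeVec_injective : Function.Injective (planeVec hn (A := A)) := by
  intro y z h
  have h1 := congrArg (fun v : H n A => (inclusion hn A)ᵀ *ᵥ (v ∘ Sum.inr)) h
  simpa [planeVec] using h1

theorem map_planeVec {B : Type} [CommRing B] (f : A →+* B) (y : Fin 2 → A) :
    f ∘ planeVec hn y = planeVec hn (f ∘ y) := by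
  ext (i | i)
  · simp [planeVec]
  · simp [planeVec, RingHom.map_mulVec, ← inclusion_map hn f]

theorem mem_plane {v : H n ℝ} : v ∈ plane hn ↔ ∃ y, v = planeVec hn y := by
  rw [plane, Submodule.mem_span_range_iff_exists_fun]
  have key : ∀ c : Fin 2 → ℝ,
      (∑ a, c a • (Pi.single (Sum.inr (idx hn a)) 1 : H n ℝ)) = planeVec hn c := by
    intro c
    ext (i | i)
    · simp [planeVec]
    · simp [planeVec, inclusion, Matrix.mulVec, dotProduct, Pi.single_apply]
  exact ⟨fun ⟨c, hc⟩ => ⟨c, by rw [← hc, key]⟩, fun ⟨c, hc⟩ => ⟨c, by rw [hc, key]⟩⟩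

theorem planeVec_mem (y : Fin 2 → ℝ) : planeVec hn y ∈ plane hn := (mem_plane hn).2 ⟨y, rfl⟩

theorem Q_planeVec (y : Fin 2 → A) (v : H n A) :
    Q (planeVec hn y) v = y ⬝ᵥ ((inclusion hn A)ᵀ *ᵥ (v ∘ Sum.inl)) := by
  rw [Q_apply, ← Matrix.vecMul_transpose, Matrix.transpose_transpose]
  have h1 : planeVec hn y ∘ Sum.inl = 0 := by ext; simp [planeVec]
  have h2 : planeVec hn y ∘ Sum.inr = inclusion hn A *ᵥ y := by ext; simp [planeVec]
  rw [h1, h2, zero_dotProduct, sub_zero, ← Matrix.vecMul_transpose, ← Matrix.dotProduct_mulVec,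
    ← Matrix.mulVec_transpose]

theorem Q_planeVec_planeVec (y z : Fin 2 → A) : Q (planeVec hn y) (planeVec hn z) = 0 := by
  rw [Q_planeVec]
  have h1 : planeVec hn z ∘ Sum.inl = 0 := by ext; simp [planeVec]
  simp [h1]

theorem symEquiv_mulVec (X : Matrix (Fin 2) (Fin 2) ℝ) (v : H n ℝ) :
    symEquiv hn X *ᵥ v = planeVec hn (-(X *ᵥ ((inclusion hn ℝ)ᵀ *ᵥ (v ∘ Sum.inl)))) := by
  rw [symEquiv, Matrix.fromBlocks_mulVec, planeVec, incl_eq]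
  simp [Matrix.neg_mulVec, Matrix.mulVec_neg, Matrix.mulVec_mulVec, Matrix.mul_assoc]

theorem Q_symEquiv_mulVec (X : Matrix (Fin 2) (Fin 2) ℝ) (u v : H n ℝ) :
    Q u (symEquiv hn X *ᵥ v) = ((inclusion hn ℝ)ᵀ *ᵥ (u ∘ Sum.inl)) ⬝ᵥ
      (X *ᵥ ((inclusion hn ℝ)ᵀ *ᵥ (v ∘ Sum.inl))) := by
  rw [symEquiv_mulVec, Q_swap, Q_planeVec, neg_dotProduct, neg_neg, dotProduct_comm]

theorem symEquiv_vecMulVec (y : Fin 2 → ℝ) :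
    symEquiv hn (Matrix.vecMulVec y y) = rankOne (planeVec hn y) := by
  refine mat_ext fun v => ?_
  rw [symEquiv_mulVec, rankOne_mulVec, Q_swap, Q_planeVec, Matrix.vecMulVec_mulVec]
  ext (i | i)
  · simp [planeVec]
  · simp [planeVec, Matrix.mulVec_smul, Matrix.mulVec_neg]
    ring

theorem symEquiv_add (X Y : Matrix (Fin 2) (Fin 2) ℝ) :
    symEquiv hn (X + Y) = symEquiv hn X + symEquiv hn Y := by
  simp [symEquiv, Matrix.fromBlocks_add, Matrix.mul_add, Matrix.add_mul, add_comm]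

theorem symEquiv_smul (c : ℝ) (X : Matrix (Fin 2) (Fin 2) ℝ) :
    symEquiv hn (c • X) = c • symEquiv hn X := by
  simp [symEquiv, Matrix.fromBlocks_smul]

/-- The identification of `Sym(2, ℝ)` with `η(S)` as a linear map. -/
def symEquivₗ : Matrix (Fin 2) (Fin 2) ℝ →ₗ[ℝ] Mat n ℝ where
  toFun := symEquiv hn
  map_add' := symEquiv_add hn
  map_smul' := symEquiv_smul hn

/-- The vector of `H` whose pairing with the plane is prescribed. -/
theorem exists_coord (y : Fin 2 → A) : ∃ v : H n A, (inclusion hn A)ᵀ *ᵥ (v ∘ Sum.inl) = y :=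
  ⟨Sum.elim (inclusion hn A *ᵥ y) 0, by simp⟩

theorem symEquiv_injective : Function.Injective (symEquiv hn) := by
  intro X Y h
  refine Matrix.ext_of_mulVec_single fun i => ?_
  obtain ⟨v, hv⟩ := exists_coord hn (Pi.single i 1 : Fin 2 → ℝ)
  have h1 := congrArg (fun N : Mat n ℝ => N *ᵥ v) h
  simp only [symEquiv_mulVec, hv] at h1
  simpa using planeVec_injective hn h1

theorem symEquiv_mem_g {X : Matrix (Fin 2) (Fin 2) ℝ} (hX : X.IsSymm) : symEquiv hn X ∈ g n ℝ := by
  refine mem_g_of_Q fun v w => ?_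
  rw [Q_swap, Q_symEquiv_mulVec, Q_symEquiv_mulVec, Matrix.dotProduct_mulVec,
    ← Matrix.mulVec_transpose, hX.eq, dotProduct_comm]

/-- For surjectivity, an endomorphism with values in the plane is determined by the form `Q(u, N
v)`. This form depends on `u` only modulo `S^⊥`, and being symmetric, it depends on `v` only modulo
`S^⊥` as well. -/
theorem bijOn_eta : Set.BijOn (symEquiv hn) {X | X.IsSymm} (eta (plane hn)) := by
  refine ⟨fun X hX => ⟨symEquiv_mem_g hn hX, fun v => ?_⟩, (symEquiv_injective hn).injOn,
    fun N hN => ?_⟩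
  · rw [symEquiv_mulVec]
    exact planeVec_mem hn _
  · obtain ⟨hg, him⟩ := hN
    choose φ hφ using fun v => (mem_plane hn).1 (him v)
    choose c hc using fun a : Fin 2 => exists_coord hn (Pi.single a 1 : Fin 2 → ℝ)
    have hQ : ∀ u v, Q u (N *ᵥ v) = Q v (N *ᵥ u) := fun u v => by
      rw [Q_swap, Q_mulVec_left hg, neg_neg]
    have hQφ : ∀ u v, Q u (N *ᵥ v) = -(φ v ⬝ᵥ ((inclusion hn ℝ)ᵀ *ᵥ (u ∘ Sum.inl))) :=
      fun u v => by rw [hφ v, Q_swap, Q_planeVec]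
    have hφa : ∀ v a, φ v a = -Q (c a) (N *ᵥ v) := fun v a => by
      rw [hQφ, hc]
      simp
    -- The Gram matrix of `φ_N` on lifts `c a` of the basis of `H_ℝ / S^⊥`.
    refine ⟨Matrix.of fun a b => Q (c a) (N *ᵥ c b), ?_, mat_ext fun v => ?_⟩
    · ext a b
      simp [hQ (c a)]
    · rw [symEquiv_mulVec, hφ v]
      congr 1
      ext a
      rw [hφa, hQ, hQφ, Pi.neg_apply]
      congr 1
      rw [Matrix.mulVec, ← neg_dotProduct]
      congr 1
      ext b
      rw [Matrix.of_apply, Pi.neg_apply, hφa, hQ, neg_neg]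

theorem forall_plane_Q_eq_zero {v : H n ℝ} :
    (∀ s ∈ plane hn, Q s v = 0) ↔ (inclusion hn ℝ)ᵀ *ᵥ (v ∘ Sum.inl) = 0 := by
  constructor
  · intro h
    ext a
    have := h _ (planeVec_mem hn (Pi.single a 1))
    rw [Q_planeVec] at this
    simpa using this
  · rintro h s hs
    obtain ⟨y, rfl⟩ := (mem_plane hn).1 hs
    rw [Q_planeVec, h, dotProduct_zero]

theorem posDef_iff {X : Matrix (Fin 2) (Fin 2) ℝ} :
    X.PosDef ↔ X.IsSymm ∧ ∀ y, y ≠ 0 → 0 < y ⬝ᵥ (X *ᵥ y) := by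
  rw [Matrix.posDef_iff_dotProduct_mulVec]
  simp [Matrix.IsHermitian, Matrix.IsSymm]

theorem symEquiv_mem_etaPos_iff {X : Matrix (Fin 2) (Fin 2) ℝ} (hX : X.IsSymm) :
    symEquiv hn X ∈ etaPos (plane hn) ↔ X.PosDef := by
  rw [posDef_iff, etaPos, Set.mem_ofPred]
  have h1 : symEquiv hn X ∈ eta (plane hn) := (bijOn_eta hn).mapsTo hX
  simp only [h1, hX, true_and, forall_plane_Q_eq_zero, Q_symEquiv_mulVec]
  constructor
  · intro h y hy
    obtain ⟨v, rfl⟩ := exists_coord hn y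
    exact h v hy
  · exact fun h v hv => h _ hv

theorem bijOn_etaPos : Set.BijOn (symEquiv hn) {X | X.PosDef} (etaPos (plane hn)) := by
  refine ⟨fun X hX => ?_, (symEquiv_injective hn).injOn, fun N hN => ?_⟩
  · exact (symEquiv_mem_etaPos_iff hn (posDef_iff.1 hX).1).2 hX
  · obtain ⟨X, hX, rfl⟩ := (bijOn_eta hn).surjOn hN.1
    exact ⟨X, (symEquiv_mem_etaPos_iff hn hX).1 hN, rfl⟩

end Plane

/-! ### Faces of finitely generated cones -/

section Cones

variable {E ι : Type*} [AddCommGroup E] [Module ℝ E] [Fintype ι]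

theorem mem_coneSpan_range {f : ι → E} {x : E} :
    x ∈ Submodule.span {c : ℝ // 0 ≤ c} (Set.range f) ↔
      ∃ a : ι → ℝ, (∀ i, 0 ≤ a i) ∧ x = ∑ i, a i • f i := by
  rw [Submodule.mem_span_range_iff_exists_fun]
  constructor
  · rintro ⟨c, rfl⟩
    exact ⟨fun i => c i, fun i => (c i).2, rfl⟩
  · rintro ⟨a, ha, rfl⟩
    exact ⟨fun i => ⟨a i, ha i⟩, rfl⟩

/-- A face of a finitely generated cone is spanned by the generators that it contains. -/
theorem face_eq_span {f : ι → E} {τ : PointedCone ℝ E}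
    (hτ : PointedCone.IsFaceOf τ (Submodule.span {c : ℝ // 0 ≤ c} (Set.range f))) :
    τ = Submodule.span {c : ℝ // 0 ≤ c} (Set.range fun i : {i // f i ∈ τ} => f i) := by
  apply le_antisymm
  · intro x hx
    obtain ⟨a, ha, rfl⟩ := mem_coneSpan_range.1 (hτ.le hx)
    refine Submodule.sum_mem _ fun i _ => ?_
    rcases (ha i).eq_or_lt with h | h
    · rw [← h, zero_smul]
      exact Submodule.zero_mem _
    · have hi : f i ∈ τ :=
        hτ.mem_of_sum_smul_mem (fun j => Submodule.subset_span ⟨j, rfl⟩) ha hx i h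
      exact PointedCone.smul_mem _ h.le (Submodule.subset_span ⟨⟨i, hi⟩, rfl⟩)
  · rw [Submodule.span_le]
    rintro _ ⟨i, rfl⟩
    exact i.2

/-- A face is recovered from the set of generators that it contains, so there are at most as many
faces as subsets of the generators. -/
theorem finite_faces (f : ι → E) :
    {τ : PointedCone ℝ E |
      PointedCone.IsFaceOf τ (Submodule.span {c : ℝ // 0 ≤ c} (Set.range f))}.Finite := by
  refine Set.Finite.of_finite_image (f := fun τ => {i | f i ∈ τ}) (Set.toFinite _) ?_
  intro τ hτ τ' hτ' h
  have h1 : ∀ i, f i ∈ τ ↔ f i ∈ τ' := fun i => Set.ext_iff.1 h i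
  rw [face_eq_span hτ, face_eq_span hτ']
  congr 1
  ext x
  simp [h1]

end Cones

/-! ### Generators of the cone `σ₀` -/

section Sigma

variable {n : ℕ} (hn : 2 ≤ n)

/-- The minimal vectors of the form `x² + xy + y²`, up to sign. -/
def minVec (A : Type) [CommRing A] : Fin 3 → Fin 2 → A := ![![1, 0], ![0, 1], ![1, -1]]

theorem map_minVec {A B : Type} [CommRing A] [CommRing B] (f : A →+* B) (k : Fin 3) :
    f ∘ minVec A k = minVec B k := by
  ext a
  fin_cases k <;> fin_cases a <;> simp [minVec]

/-- The vectors whose rank one endomorphisms generate `σ₀`. -/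
def genVec (A : Type) [CommRing A] (k : Fin 3) : H n A := planeVec hn (minVec A k)

theorem map_genVec {A B : Type} [CommRing A] [CommRing B] (f : A →+* B) (k : Fin 3) :
    f ∘ genVec hn A k = genVec hn B k := by
  rw [genVec, map_planeVec, map_minVec, genVec]

theorem Q_genVec_genVec {A : Type} [CommRing A] (j k : Fin 3) :
    Q (genVec hn A j) (genVec hn A k) = 0 := Q_planeVec_planeVec hn _ _

theorem sigmaZero_eq : sigmaZero hn =
    Submodule.span {c : ℝ // 0 ≤ c} (Set.range fun k => rankOne (genVec hn ℝ k)) := by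
  have h : ∀ k, rankOne (genVec hn ℝ k) =
      symEquiv hn ((![!![1, 0; 0, 0], !![0, 0; 0, 1], !![1, -1; -1, 1]] : Fin 3 → _) k) := by
    intro k
    rw [genVec, ← symEquiv_vecMulVec]
    congr 1
    ext a b
    fin_cases k <;> fin_cases a <;> fin_cases b <;> simp [minVec, Matrix.vecMulVec_apply]
  simp only [h, sigmaZero]
  congr 1
  ext N
  simp [Fin.exists_fin_succ, eq_comm]

theorem mem_sigmaZero {N : Mat n ℝ} : N ∈ sigmaZero hn ↔
    ∃ a : Fin 3 → ℝ, (∀ k, 0 ≤ a k) ∧ N = ∑ k, a k • rankOne (genVec hn ℝ k) := by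
  rw [sigmaZero_eq]
  exact mem_coneSpan_range

theorem mem_translate_sigmaZero {γ : GZ n} {N : Mat n ℝ} : N ∈ (sigmaZero hn).translate γ ↔
    ∃ a : Fin 3 → ℝ, (∀ k, 0 ≤ a k) ∧
      N = ∑ k, a k • rankOne (cast ℝ γ *ᵥ genVec hn ℝ k) := by
  rw [mem_translate]
  simp only [mem_sigmaZero]
  constructor
  · rintro ⟨_, ⟨a, ha, rfl⟩, rfl⟩
    exact ⟨a, ha, by simp [map_sum, Ad_rankOne]⟩
  · rintro ⟨a, ha, rfl⟩
    exact ⟨_, ⟨a, ha, rfl⟩, by simp [map_sum, Ad_rankOne]⟩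

theorem rankOne_genVec_mem (k : Fin 3) : rankOne (genVec hn ℝ k) ∈ sigmaZero hn := by
  rw [sigmaZero_eq]
  exact Submodule.subset_span ⟨k, rfl⟩

/-! ### Comparison of `σ₀` with its translates through integral vectors. -/

theorem Q_sum_rankOne {ι : Type*} [Fintype ι] (a : ι → ℝ) (w : ι → H n ℝ) (u : H n ℝ) :
    Q u ((∑ k, a k • rankOne (w k)) *ᵥ u) = ∑ k, a k * Q u (w k) ^ 2 := by
  rw [Matrix.sum_mulVec, Q_sum_right]
  simp only [Matrix.smul_mulVec, rankOne_mulVec, Q_smul_right]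
  exact Finset.sum_congr rfl fun k _ => by ring

theorem cast_comp_intCast (γ : GZ n) (w : H n ℤ) :
    (Int.castRingHom ℝ) ∘ (cast ℤ γ *ᵥ w) = cast ℝ γ *ᵥ ((Int.castRingHom ℝ) ∘ w) := by
  ext i
  rw [Function.comp_apply, RingHom.map_mulVec, ← cast_map (Int.castRingHom ℝ)]

/-- A vector orthogonal to the orthogonal complement of the plane lies in the plane. -/
theorem exists_eq_planeVec {A : Type} [CommRing A] (w : H n A)
    (hl : ∀ i, w (Sum.inl i) = 0) (hr : ∀ i, (∀ a, i ≠ idx hn a) → w (Sum.inr i) = 0) :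
    ∃ y, w = planeVec hn y := by
  refine ⟨fun a => w (Sum.inr (idx hn a)), ?_⟩
  ext (i | i)
  · simpa [planeVec] using hl i
  · simp only [planeVec, Sum.elim_inr, Matrix.mulVec, dotProduct, inclusion, Matrix.of_apply,
      ite_mul, one_mul, zero_mul]
    by_cases h : ∃ a, i = idx hn a
    · obtain ⟨a, rfl⟩ := h
      simp [(idx_injective hn).eq_iff]
    · push Not at h
      rw [hr i h, Finset.sum_eq_zero]
      intro a _
      rw [if_neg (h a)]

theorem Q_single_inl {A : Type} [CommRing A] (i : Fin n) (w : H n A) :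
    Q (Pi.single (Sum.inl i) 1) w = -w (Sum.inr i) := by
  rw [Q_swap, Q_apply]
  simp [dotProduct, Pi.single_apply]

theorem Q_single_inr {A : Type} [CommRing A] (i : Fin n) (w : H n A) :
    Q (Pi.single (Sum.inr i) 1) w = w (Sum.inl i) := by
  rw [Q_apply]
  simp [dotProduct, Pi.single_apply]

/-- If an element of `σ₀` is a combination of translated generators, then those translated
generators that occur lie in the plane. -/
theorem exists_planeVec_of_sum_eq {γ : GZ n} {a b : Fin 3 → ℝ}
    (hb : ∀ k, 0 ≤ b k)
    (h : ∑ k, a k • rankOne (genVec hn ℝ k) = ∑ k, b k • rankOne (cast ℝ γ *ᵥ genVec hn ℝ k))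
    {j : Fin 3} (hj : b j ≠ 0) :
    ∃ y : Fin 2 → ℤ, cast ℤ γ *ᵥ genVec hn ℤ j = planeVec hn y := by
  -- For `u` orthogonal to the generators, `Q(u, N u)` vanishes. Computed from the translated
  -- generators it is a sum of nonnegative terms, so each term vanishes.
  have key : ∀ u : H n ℝ, (∀ k, Q u (genVec hn ℝ k) = 0) →
      Q u (cast ℝ γ *ᵥ genVec hn ℝ j) = 0 := by
    intro u hu
    have h1 := congrArg (fun N : Mat n ℝ => Q u (N *ᵥ u)) h
    simp only [Q_sum_rankOne, hu] at h1
    have h2 := (Finset.sum_eq_zero_iff_of_nonneg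
      (fun k _ => mul_nonneg (hb k) (sq_nonneg _))).1 (h1.symm.trans (by simp)) j
      (Finset.mem_univ j)
    simpa [hj] using h2
  have hcast : ∀ i, (((cast ℤ γ *ᵥ genVec hn ℤ j) i : ℤ) : ℝ) =
      (cast ℝ γ *ᵥ genVec hn ℝ j) i := by
    intro i
    have := congrFun (cast_comp_intCast γ (genVec hn ℤ j)) i
    rwa [map_genVec] at this
  -- The basis vectors orthogonal to the generators include all `e_{n+i}` and the `e_i` outside the
  -- last two indices. Pairing with them kills every coordinate off the plane.
  apply exists_eq_planeVec
  · intro i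
    have := key (Pi.single (Sum.inr i) 1) (fun k => by
      rw [Q_single_inr]
      simp [genVec, planeVec])
    rw [Q_single_inr, ← hcast] at this
    exact_mod_cast this
  · intro i hi
    have := key (Pi.single (Sum.inl i) 1) (fun k => by
      rw [Q_single_inl]
      simp [genVec, planeVec, inclusion, Matrix.mulVec, dotProduct, hi])
    rw [Q_single_inl, ← hcast, neg_eq_zero] at this
    exact_mod_cast this

/-- The binary quadratic form `x² + xy + y²`. -/
def hexForm {A : Type} [CommRing A] (y : Fin 2 → A) : A := y 0 ^ 2 + y 0 * y 1 + y 1 ^ 2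

theorem one_le_hexForm {y : Fin 2 → ℤ} (hy : y ≠ 0) : 1 ≤ hexForm y := by
  have h : y 0 ≠ 0 ∨ y 1 ≠ 0 := by
    by_contra! hc
    apply hy
    ext a
    fin_cases a
    · exact hc.1
    · exact hc.2
  rw [hexForm]
  -- Four times the form is `(x + 2y)² + 3x²`, and likewise with `x` and `y` exchanged.
  rcases h with h | h <;> have := sq_pos_of_ne_zero h <;>
    nlinarith [sq_nonneg (y 0 + 2 * y 1), sq_nonneg (2 * y 0 + y 1)]

theorem eq_minVec_of_hexForm_eq_one {y : Fin 2 → ℤ} (hy : hexForm y = 1) :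
    ∃ k, y = minVec ℤ k ∨ y = -minVec ℤ k := by
  rw [hexForm] at hy
  have h1 : y 0 ^ 2 ≤ 1 := by nlinarith [sq_nonneg (y 0 + 2 * y 1)]
  have h2 : y 1 ^ 2 ≤ 1 := by nlinarith [sq_nonneg (2 * y 0 + y 1)]
  obtain ⟨h3, h4⟩ := abs_le.1 (sq_le_one_iff_abs_le_one _ |>.1 h1)
  obtain ⟨h5, h6⟩ := abs_le.1 (sq_le_one_iff_abs_le_one _ |>.1 h2)
  have hy' : y = ![y 0, y 1] := by
    ext a
    fin_cases a <;> rfl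
  generalize y 0 = p at *
  generalize y 1 = q at *
  subst hy'
  interval_cases p <;> interval_cases q <;> simp_all [Fin.exists_fin_succ, minVec]

/-- The linear functional on endomorphisms given by the pairing with the form `x² + xy + y²`. -/
def hexTrace : Mat n ℝ →ₗ[ℝ] ℝ where
  toFun N := -(N (Sum.inr (idx hn 0)) (Sum.inl (idx hn 0)) +
    N (Sum.inr (idx hn 0)) (Sum.inl (idx hn 1)) + N (Sum.inr (idx hn 1)) (Sum.inl (idx hn 1)))
  map_add' M N := by
    simp only [Matrix.add_apply]
    ring
  map_smul' c N := by
    simp only [Matrix.smul_apply, smul_eq_mul, RingHom.id_apply]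
    ring

theorem hexTrace_rankOne (y : Fin 2 → ℝ) : hexTrace hn (rankOne (planeVec hn y)) = hexForm y := by
  have h : ∀ a b, rankOne (planeVec hn y) (Sum.inr (idx hn a)) (Sum.inl (idx hn b)) =
      -(y a * y b) := by
    intro a b
    rw [← symEquiv_vecMulVec, symEquiv]
    simp [Matrix.mul_apply, incl, (idx_injective hn).eq_iff, Matrix.vecMulVec_apply]
  simp only [hexTrace, LinearMap.coe_mk, AddHom.coe_mk, h, hexForm]
  ring

theorem hexForm_minVec (k : Fin 3) : hexForm (minVec ℝ k) = 1 := by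
  fin_cases k <;> norm_num [hexForm, minVec]

theorem intCast_hexForm (y : Fin 2 → ℤ) :
    hexForm ((Int.castRingHom ℝ) ∘ y) = ((hexForm y : ℤ) : ℝ) := by
  simp [hexForm]

theorem genVec_ne_zero (k : Fin 3) : genVec hn ℤ k ≠ 0 := by
  rw [genVec, ← planeVec_zero hn]
  refine fun h => ?_
  have := planeVec_injective hn h
  fin_cases k <;> simp [minVec] at this

/-- If an element of `σ₀` is a combination of translated generators, then the translated generators
have total weight at most the weight of the generators, with equality only if each translated
generator that occurs is a generator. -/
theorem sum_le_of_sum_eq {γ : GZ n} {a b : Fin 3 → ℝ} (hb : ∀ k, 0 ≤ b k)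
    (h : ∑ k, a k • rankOne (genVec hn ℝ k) = ∑ k, b k • rankOne (cast ℝ γ *ᵥ genVec hn ℝ k)) :
    ∑ k, b k ≤ ∑ k, a k ∧ (∑ k, b k = ∑ k, a k → ∀ j, b j ≠ 0 → ∃ k,
      cast ℤ γ *ᵥ genVec hn ℤ j = genVec hn ℤ k ∨
      cast ℤ γ *ᵥ genVec hn ℤ j = -genVec hn ℤ k) := by
  -- Translated generators of weight zero need not lie in the plane; `y = 0` is a dummy value for
  -- them.
  have hy : ∀ j, ∃ y : Fin 2 → ℤ, b j ≠ 0 → cast ℤ γ *ᵥ genVec hn ℤ j = planeVec hn y := by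
    intro j
    by_cases hj : b j = 0
    · exact ⟨0, fun h => absurd hj h⟩
    · obtain ⟨y, hy⟩ := exists_planeVec_of_sum_eq hn hb h hj
      exact ⟨y, fun _ => hy⟩
  choose y hy using hy
  have hy0 : ∀ j, b j ≠ 0 → 1 ≤ hexForm (y j) := by
    intro j hj
    apply one_le_hexForm
    intro h0
    have h1 := hy j hj
    rw [h0] at h1
    apply genVec_ne_zero hn j
    rw [← cast_inv_mulVec γ (genVec hn ℤ j), h1]
    rw [planeVec_zero, Matrix.mulVec_zero]
  -- Apply `hexTrace` to both expressions of the same endomorphism.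
  have hsum : ∑ k, a k = ∑ k, b k * (hexForm (y k) : ℤ) := by
    have h1 := congrArg (hexTrace hn) h
    rw [map_sum, map_sum] at h1
    simp only [map_smul, smul_eq_mul, genVec, hexTrace_rankOne, hexForm_minVec, mul_one] at h1
    rw [h1]
    refine Finset.sum_congr rfl fun k _ => ?_
    by_cases hk : b k = 0
    · simp [hk]
    · congr 1
      rw [← intCast_hexForm, ← hexTrace_rankOne hn, ← map_planeVec, ← hy k hk, cast_comp_intCast,
        map_genVec, genVec]
  have hle : ∀ k, b k ≤ b k * (hexForm (y k) : ℤ) := by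
    intro k
    by_cases hk : b k = 0
    · simp [hk]
    · exact le_mul_of_one_le_right (hb k) (by exact_mod_cast hy0 k hk)
  refine ⟨hsum ▸ Finset.sum_le_sum fun k _ => hle k, fun heq j hj => ?_⟩
  -- Equal totals force termwise equality, so the form has value `1` wherever the weight is nonzero,
  -- and such vectors are minimal.
  have h1 := (Finset.sum_eq_sum_iff_of_le fun k _ => hle k).1 (heq.trans hsum) j
    (Finset.mem_univ j)
  have h2 : (hexForm (y j) : ℤ) = 1 := by
    have : (1 : ℝ) = (hexForm (y j) : ℤ) := mul_left_cancel₀ hj (by rw [mul_one]; exact h1)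
    exact_mod_cast this.symm
  obtain ⟨k, hk⟩ := eq_minVec_of_hexForm_eq_one h2
  refine ⟨k, ?_⟩
  rw [hy j hj]
  rcases hk with hk | hk
  · exact Or.inl (by rw [hk, genVec])
  · exact Or.inr (by rw [hk, planeVec_neg, genVec])

/-- The cone `σ₀` meets each of its translates in a face. -/
theorem inf_translate_isFaceOf (γ : GZ n) :
    PointedCone.IsFaceOf (sigmaZero hn ⊓ (sigmaZero hn).translate γ) (sigmaZero hn) := by
  -- It remains to show that if a sum of two elements of `σ₀` lies in the translate, so does the
  -- first summand.
  refine PointedCone.IsFaceOf.of_mem_of_add_mem_left inf_le_left fun {x z} hx hz hxz => ⟨hx, ?_⟩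
  obtain ⟨p, hp, rfl⟩ := (mem_sigmaZero hn).1 hx
  obtain ⟨q, hq, rfl⟩ := (mem_sigmaZero hn).1 hz
  obtain ⟨b, hb, hpq⟩ := (mem_translate_sigmaZero hn).1 hxz.2
  have ha : ∀ k, 0 ≤ (p + q) k := fun k => add_nonneg (hp k) (hq k)
  have h1 : ∑ k, (p + q) k • rankOne (genVec hn ℝ k) =
      ∑ k, b k • rankOne (cast ℝ γ *ᵥ genVec hn ℝ k) := by
    rw [← hpq, ← Finset.sum_add_distrib]
    simp [add_smul]
  -- Conjugating by `γ⁻¹` exchanges the roles of the two cones, so the weight comparison applies in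
  -- both directions and its equality case becomes available.
  have h2 : ∑ k, b k • rankOne (genVec hn ℝ k) =
      ∑ k, (p + q) k • rankOne (cast ℝ γ⁻¹ *ᵥ genVec hn ℝ k) := by
    have := congrArg (Ad γ⁻¹) h1
    simpa only [map_sum, map_smul, Ad_rankOne, cast_inv_mulVec] using this.symm
  obtain ⟨hle, -⟩ := sum_le_of_sum_eq hn hb h1
  obtain ⟨hle', heq⟩ := sum_le_of_sum_eq hn ha h2
  refine Submodule.sum_mem _ fun k _ => ?_
  rcases (hp k).eq_or_lt with h0 | h0
  · rw [← h0, zero_smul]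
    exact Submodule.zero_mem _
  refine PointedCone.smul_mem _ h0.le ?_
  obtain ⟨j, hj⟩ := heq (le_antisymm hle' hle) k (add_pos_of_pos_of_nonneg h0 (hq k)).ne'
  refine mem_translate.2 ⟨_, rankOne_genVec_mem hn j, ?_⟩
  -- The sign is harmless because a vector and its negative give the same rank one endomorphism.
  have h3 : genVec hn ℤ k = cast ℤ γ *ᵥ genVec hn ℤ j ∨
      genVec hn ℤ k = -(cast ℤ γ *ᵥ genVec hn ℤ j) := by
    rw [← cast_mulVec_inv γ (genVec hn ℤ k)]
    rcases hj with hj | hj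
    · exact Or.inl (by rw [hj])
    · exact Or.inr (by rw [hj, Matrix.mulVec_neg])
  rw [Ad_rankOne, ← map_genVec hn (Int.castRingHom ℝ) j, ← map_genVec hn (Int.castRingHom ℝ) k,
    ← cast_comp_intCast, ← rankOne_map, ← rankOne_map]
  rcases h3 with h3 | h3
  · rw [h3]
  · rw [h3, rankOne_neg]

/-! ### Fans formed by translates of the faces of `σ₀`. -/

/-- The set of all translates by elements of `A` of the faces of `σ₀`. -/
def faceTranslates (A : Set (GZ n)) : Set (Cone n) :=
  {σ | ∃ γ ∈ A, ∃ τ : Cone n, PointedCone.IsFaceOf τ (sigmaZero hn) ∧ σ = τ.translate γ}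

theorem sigmaS_eq (Γ : Subgroup (GZ n)) :
    SigmaS hn Γ = faceTranslates hn (stab Γ (plane hn) : Set (GZ n)) := rfl

/-- Both families of the main theorem are of the form `faceTranslates`, with index set `Γ(S)` or
`Γ`. A single fan argument for an arbitrary nonempty set of group elements thus serves both. -/
theorem translates_sigmaS_eq (Γ : Subgroup (GZ n)) :
    translates Γ (SigmaS hn Γ) = faceTranslates hn (Γ : Set (GZ n)) := by
  ext σ
  constructor
  · rintro ⟨γ, hγ, _, ⟨δ, hδ, τ, hτ, rfl⟩, rfl⟩
    exact ⟨γ * δ, Γ.mul_mem hγ hδ.1, τ, hτ, (translate_mul γ δ τ).symm⟩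
  · rintro ⟨γ, hγ, τ, hτ, rfl⟩
    exact ⟨γ, hγ, τ, ⟨1, Subgroup.one_mem _, τ, hτ, (translate_one τ).symm⟩, rfl⟩

/-- The intersection is a face of `σ₀ ∩ γ σ₀`, hence of `σ₀` by transitivity; a face of `σ₀`
contained in the face `τ` is a face of `τ`. -/
theorem inf_translate_isFaceOf_of_face {τ τ' : Cone n}
    (hτ : PointedCone.IsFaceOf τ (sigmaZero hn)) (hτ' : PointedCone.IsFaceOf τ' (sigmaZero hn))
    (γ : GZ n) : PointedCone.IsFaceOf (τ ⊓ τ'.translate γ) τ :=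
  (PointedCone.IsFaceOf.isFaceOf_iff_le
    ((hτ.inf (isFaceOf_translate.2 hτ')).trans (inf_translate_isFaceOf hn γ)) hτ).2 inf_le_left

/-- A face of `σ₀` is generated by some of the three generators. -/
theorem exists_isGenerating {τ : Cone n} (hτ : PointedCone.IsFaceOf τ (sigmaZero hn)) :
    ∃ (ℓ : ℕ) (κ : Fin ℓ → Fin 3), IsGenerating (fun j => rankOne (genVec hn ℚ (κ j))) τ := by
  classical
  rw [sigmaZero_eq] at hτ
  let e := (Fintype.equivFin {k // rankOne (genVec hn ℝ k) ∈ τ}).symm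
  refine ⟨_, fun j => e j, fun j => rankOne_mem_g _, fun j => ⟨2, ?_⟩, fun j k => ?_, ?_⟩
  · rw [pow_two]
    exact rankOne_mul_rankOne _ _ (Q_genVec_genVec hn _ _)
  · rw [commute_iff_eq, rankOne_mul_rankOne _ _ (Q_genVec_genVec hn _ _),
      rankOne_mul_rankOne _ _ (Q_genVec_genVec hn _ _)]
  · conv_rhs => rw [face_eq_span hτ]
    simp only [rankOne_map, map_genVec]
    congr 1
    exact e.surjective.range_comp
      (fun k : {k // rankOne (genVec hn ℝ k) ∈ τ} => rankOne (genVec hn ℝ k.1))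

/-- On `σ₀` the functional `hexTrace` is the sum of the weights, so it is nonnegative and vanishes
only at the origin. -/
theorem sigmaZero_salient : (PointedCone.toConvexCone (sigmaZero hn)).Salient := by
  intro x hx hx0 hneg
  obtain ⟨a, ha, hxa⟩ := (mem_sigmaZero hn).1 hx
  obtain ⟨b, hb, hxb⟩ := (mem_sigmaZero hn).1 hneg
  have key : ∀ c : Fin 3 → ℝ, hexTrace hn (∑ k, c k • rankOne (genVec hn ℝ k)) = ∑ k, c k := by
    intro c
    simp [map_sum, genVec, hexTrace_rankOne, hexForm_minVec]
  have h1 : hexTrace hn x = ∑ k, a k := by rw [hxa, key]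
  have h2 : hexTrace hn (-x) = ∑ k, b k := by rw [hxb, key]
  rw [map_neg, h1] at h2
  have h3 : ∑ k, a k = 0 := le_antisymm
    (by linarith [Finset.sum_nonneg fun k (_ : k ∈ Finset.univ) => hb k])
    (Finset.sum_nonneg fun k _ => ha k)
  have h4 := (Finset.sum_eq_zero_iff_of_nonneg fun k _ => ha k).1 h3
  exact hx0 (by rw [hxa]; simp [fun k => h4 k (Finset.mem_univ k)])

theorem isFan_faceTranslates {A : Set (GZ n)} (hA : A.Nonempty) : IsFan (faceTranslates hn A) where
  nonempty := by
    obtain ⟨γ, hγ⟩ := hA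
    exact ⟨_, γ, hγ, _, PointedCone.IsFaceOf.rfl, rfl⟩
  nilpotent := by
    rintro _ ⟨γ, -, τ, hτ, rfl⟩
    obtain ⟨ℓ, κ, h⟩ := exists_isGenerating hn hτ
    exact IsNilpotentCone.translate ⟨ℓ, _, h⟩ γ
  salient := by
    rintro _ ⟨γ, -, τ, hτ, rfl⟩ x hx hx0 hneg
    obtain ⟨y, hy, rfl⟩ := mem_translate.1 hx
    obtain ⟨z, hz, hzy⟩ := mem_translate.1 hneg
    rw [← map_neg] at hzy
    have hzy := Ad_injective γ hzy
    subst hzy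
    exact sigmaZero_salient hn y (hτ.le hy) (fun h => hx0 (by rw [h, map_zero])) (hτ.le hz)
  face_mem := by
    rintro _ ⟨γ, hγ, τ, hτ, rfl⟩ ρ hρ
    refine ⟨γ, hγ, ρ.translate γ⁻¹, ?_, (translate_translate_inv γ ρ).symm⟩
    have := (isFaceOf_translate (γ := γ⁻¹)).2 hρ
    rw [translate_inv_translate] at this
    exact this.trans hτ
  inter_face := by
    rintro _ ⟨γ, hγ, τ, hτ, rfl⟩ _ ⟨δ, hδ, τ', hτ', rfl⟩
    -- Moving the first cone back by `γ⁻¹` leaves a face of `σ₀` and a translate by `γ⁻¹ δ`, which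
    -- may be any element of `G_ℤ`.
    have := (isFaceOf_translate (γ := γ)).2 (inf_translate_isFaceOf_of_face hn hτ hτ' (γ⁻¹ * δ))
    rwa [translate_inf, ← translate_mul, mul_inv_cancel_left] at this

end Sigma

/-! ### Reduction of binary quadratic forms -/

section Reduction

/-- The bilinear form of a real binary form on integral vectors. -/
def binForm (X : Matrix (Fin 2) (Fin 2) ℝ) (r s : Fin 2 → ℤ) : ℝ :=
  X 0 0 * (r 0 * s 0) + X 0 1 * (r 0 * s 1 + r 1 * s 0) + X 1 1 * (r 1 * s 1)

/-- Completing the square bounds the determinant times the square of either coordinate by a diagonal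
entry times the value of the form, leaving integral points of a bounded box. -/
theorem finite_binForm_le {X : Matrix (Fin 2) (Fin 2) ℝ} (h0 : 0 < X 0 0) (h1 : 0 < X 1 1)
    (hdet : 0 < X 0 0 * X 1 1 - X 0 1 ^ 2) (C : ℝ) :
    {r : Fin 2 → ℤ | binForm X r r ≤ C}.Finite := by
  -- Using the trace instead of a single diagonal entry gives one bound valid for both squared
  -- coordinates.
  set M : ℝ := (X 0 0 + X 1 1) * C / (X 0 0 * X 1 1 - X 0 1 ^ 2) with hM
  refine (Set.finite_Icc (fun _ => -⌈|M| + 1⌉ : Fin 2 → ℤ) (fun _ => ⌈|M| + 1⌉)).subset ?_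
  intro r hr
  have hr : binForm X r r ≤ C := hr
  have hq : 0 ≤ binForm X r r := by
    have : 0 ≤ X 0 0 * binForm X r r := by
      have e : X 0 0 * binForm X r r = (X 0 0 * r 0 + X 0 1 * r 1) ^ 2 +
          (X 0 0 * X 1 1 - X 0 1 ^ 2) * (r 1 : ℝ) ^ 2 := by
        rw [binForm]
        ring
      rw [e]
      positivity
    exact nonneg_of_mul_nonneg_right this h0
  have e0 : (X 0 0 * X 1 1 - X 0 1 ^ 2) * (r 0 : ℝ) ^ 2 ≤ X 1 1 * binForm X r r := by
    have e : X 1 1 * binForm X r r = (X 0 1 * r 0 + X 1 1 * r 1) ^ 2 +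
        (X 0 0 * X 1 1 - X 0 1 ^ 2) * (r 0 : ℝ) ^ 2 := by
      rw [binForm]
      ring
    nlinarith [sq_nonneg (X 0 1 * r 0 + X 1 1 * r 1)]
  have e1 : (X 0 0 * X 1 1 - X 0 1 ^ 2) * (r 1 : ℝ) ^ 2 ≤ X 0 0 * binForm X r r := by
    have e : X 0 0 * binForm X r r = (X 0 0 * r 0 + X 0 1 * r 1) ^ 2 +
        (X 0 0 * X 1 1 - X 0 1 ^ 2) * (r 1 : ℝ) ^ 2 := by
      rw [binForm]
      ring
    nlinarith [sq_nonneg (X 0 0 * r 0 + X 0 1 * r 1)]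
  have b0 : (r 0 : ℝ) ^ 2 ≤ M := by
    rw [hM, le_div_iff₀ hdet]
    nlinarith [mul_nonneg h0.le hq]
  have b1 : (r 1 : ℝ) ^ 2 ≤ M := by
    rw [hM, le_div_iff₀ hdet]
    nlinarith [mul_nonneg h1.le hq]
  have hb : ∀ a, |(r a : ℝ)| ≤ |M| + 1 := by
    intro a
    have : (r a : ℝ) ^ 2 ≤ M := by
      fin_cases a
      · exact b0
      · exact b1
    have h2 := le_abs_self M
    rw [← sq_abs] at this
    nlinarith [sq_nonneg (|(r a : ℝ)| - 1), abs_nonneg (r a : ℝ)]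
  have hc : ∀ a, |r a| ≤ ⌈|M| + 1⌉ := by
    intro a
    have : ((|r a| : ℤ) : ℝ) ≤ (⌈|M| + 1⌉ : ℝ) := by
      rw [Int.cast_abs]
      exact (hb a).trans (Int.le_ceil _)
    exact_mod_cast this
  exact ⟨fun a => (abs_le.1 (hc a)).1, fun a => (abs_le.1 (hc a)).2⟩

/-- Every positive definite binary form has an obtuse superbase. -/
theorem exists_obtuse_basis {X : Matrix (Fin 2) (Fin 2) ℝ} (h0 : 0 < X 0 0) (h1 : 0 < X 1 1)
    (hdet : 0 < X 0 0 * X 1 1 - X 0 1 ^ 2) :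
    ∃ r s : Fin 2 → ℤ, (r 0 * s 1 - r 1 * s 0) ^ 2 = 1 ∧ 0 ≤ binForm X r r + binForm X r s ∧
      0 ≤ binForm X s s + binForm X r s ∧ binForm X r s ≤ 0 := by
  -- This is half of `X(r, r) + X(s, s) + X(r+s, r+s)`, the quantity minimized in Selling reduction.
  -- In this form it visibly bounds `X(r, r)` and `X(s, s)`, so its sublevel sets are finite.
  let f : (Fin 2 → ℤ) × (Fin 2 → ℤ) → ℝ := fun p =>
    binForm X p.1 p.1 + binForm X p.2 p.2 + binForm X p.1 p.2
  let T : Set ((Fin 2 → ℤ) × (Fin 2 → ℤ)) := {p | (p.1 0 * p.2 1 - p.1 1 * p.2 0) ^ 2 = 1}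
  let p₀ : (Fin 2 → ℤ) × (Fin 2 → ℤ) := (![1, 0], ![0, 1])
  have hp₀ : p₀ ∈ T := by simp [p₀, T]
  have hpos : ∀ r, 0 ≤ binForm X r r := by
    intro r
    have : 0 ≤ X 0 0 * binForm X r r := by
      have e : X 0 0 * binForm X r r = (X 0 0 * r 0 + X 0 1 * r 1) ^ 2 +
          (X 0 0 * X 1 1 - X 0 1 ^ 2) * (r 1 : ℝ) ^ 2 := by
        rw [binForm]
        ring
      rw [e]
      positivity
    exact nonneg_of_mul_nonneg_right this h0
  have hf : ∀ p, binForm X p.1 p.1 ≤ 2 * f p ∧ binForm X p.2 p.2 ≤ 2 * f p := by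
    intro p
    have e : 2 * f p = binForm X p.1 p.1 + binForm X p.2 p.2 +
        binForm X (p.1 + p.2) (p.1 + p.2) := by
      simp only [f, binForm, Pi.add_apply, Int.cast_add]
      ring
    rw [e]
    constructor <;> linarith [hpos p.1, hpos p.2, hpos (p.1 + p.2)]
  have hfin : {p | p ∈ T ∧ f p ≤ f p₀}.Finite := by
    have h2 := finite_binForm_le h0 h1 hdet (2 * f p₀)
    refine (h2.prod h2).subset ?_
    rintro p ⟨-, hp⟩
    exact ⟨(hf p).1.trans (by linarith), (hf p).2.trans (by linarith)⟩
  obtain ⟨⟨r, s⟩, ⟨hT, hle⟩, hmin⟩ := Set.exists_min_image _ f hfin ⟨p₀, hp₀, le_rfl⟩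
  have hmin' : ∀ p ∈ T, f (r, s) ≤ f p := by
    intro p hp
    rcases le_total (f p) (f p₀) with h | h
    · exact hmin p ⟨hp, h⟩
    · exact hle.trans h
  have hT' : (r 0 * s 1 - r 1 * s 0) ^ 2 = 1 := hT
  -- The three competitors are the bases of the neighbouring superbases of `{r, s, -r-s}`.
  -- Comparison with each of them yields one of the three sign conditions.
  have m1 := hmin' (r, -s) (by
    simp only [T, Set.mem_ofPred_eq, Pi.neg_apply]
    linear_combination hT')
  have m2 := hmin' (r, -(r + r) - s) (by
    simp only [T, Set.mem_ofPred_eq, Pi.neg_apply, Pi.sub_apply, Pi.add_apply]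
    linear_combination hT')
  have m3 := hmin' (-r - (s + s), s) (by
    simp only [T, Set.mem_ofPred_eq, Pi.neg_apply, Pi.sub_apply, Pi.add_apply]
    linear_combination hT')
  simp only [f, binForm, Pi.neg_apply, Pi.sub_apply, Pi.add_apply, Int.cast_neg,
    Int.cast_sub, Int.cast_add] at m1 m2 m3
  refine ⟨r, s, hT', ?_, ?_, ?_⟩ <;> simp only [binForm]
  · linarith
  · linarith
  · linarith

/-- Every positive definite binary form is, up to an integral change of basis, a nonnegative
combination of the three rank one forms given by the minimal vectors. -/
theorem exists_reduction {X : Matrix (Fin 2) (Fin 2) ℝ} (hX : X.PosDef) :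
    ∃ g h : Matrix (Fin 2) (Fin 2) ℤ, g * h = 1 ∧ h * g = 1 ∧ ∃ a : Fin 3 → ℝ, (∀ k, 0 ≤ a k) ∧
      X = ∑ k, a k • Matrix.vecMulVec (h.map (Int.castRingHom ℝ) *ᵥ minVec ℝ k)
        (h.map (Int.castRingHom ℝ) *ᵥ minVec ℝ k) := by
  have h0 : 0 < X 0 0 := hX.diag_pos
  have h1 : 0 < X 1 1 := hX.diag_pos
  have hs : X 1 0 = X 0 1 := congrFun (congrFun (posDef_iff.1 hX).1 0) 1
  have hdet : 0 < X 0 0 * X 1 1 - X 0 1 ^ 2 := by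
    have := hX.det_pos
    rw [Matrix.det_fin_two, hs] at this
    linarith
  obtain ⟨r, s, hd, ha, hb, hc⟩ := exists_obtuse_basis h0 h1 hdet
  have hdR : ((r 0 : ℝ) * s 1 - r 1 * s 0) ^ 2 = 1 := by exact_mod_cast hd
  -- The rows of the first matrix are `r` and `s`. Its determinant is `±1`, so the determinant times
  -- the adjugate is the inverse. The weights come from `Aξ² + 2Bξη + Cη² = (A+B)ξ² + (C+B)η² -
  -- B(ξ-η)²`.
  refine ⟨!![r 0, r 1; s 0, s 1], (r 0 * s 1 - r 1 * s 0) • !![s 1, -r 1; -s 0, r 0],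
    ?_, ?_,
    ![binForm X r r + binForm X r s, binForm X s s + binForm X r s, -binForm X r s], ?_, ?_⟩
  · ext i j
    fin_cases i <;> fin_cases j <;> simp [Matrix.mul_apply] <;>
      first | linear_combination hd | ring
  · ext i j
    fin_cases i <;> fin_cases j <;> simp [Matrix.mul_apply] <;>
      first | linear_combination hd | ring
  · intro k
    fin_cases k
    · exact ha
    · exact hb
    · simpa using hc
  -- Expanding the right-hand side produces `X` times the fourth power of the determinant: two
  -- factors come from the scalar in the inverse, two from the adjugate.
  · have e : ∀ x : ℝ, x = x * (((r 0 : ℝ) * s 1 - r 1 * s 0) ^ 2) ^ 2 := by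
      intro x
      rw [hdR]
      ring
    ext i j
    fin_cases i <;> fin_cases j <;>
      simp [Fin.sum_univ_three, minVec, binForm]
    · refine (e (X 0 0)).trans ?_
      ring
    · refine (e (X 0 1)).trans ?_
      ring
    · refine hs.trans ((e (X 0 1)).trans ?_)
      ring
    · refine (e (X 1 1)).trans ?_
      ring

end Reduction

/-! ### The polyhedral decomposition -/

section Decomposition

variable {n : ℕ} (hn : 2 ≤ n)

/-- The endomorphism of `A^n` that acts by `h` on the two last coordinates. -/
def extend {A : Type} [CommRing A] (h : Matrix (Fin 2) (Fin 2) A) : Matrix (Fin n) (Fin n) A :=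
  1 + inclusion hn A * (h - 1) * (inclusion hn A)ᵀ

theorem extend_mul {A : Type} [CommRing A] (g h : Matrix (Fin 2) (Fin 2) A) :
    extend hn g * extend hn h = extend hn (g * h) := by
  have key : ∀ p q : Matrix (Fin 2) (Fin 2) A,
      inclusion hn A * p * (inclusion hn A)ᵀ * (inclusion hn A * q * (inclusion hn A)ᵀ) =
        inclusion hn A * (p * q) * (inclusion hn A)ᵀ := by
    intro p q
    calc _ = inclusion hn A * p * ((inclusion hn A)ᵀ * inclusion hn A) * q * (inclusion hn A)ᵀ := by
          simp only [Matrix.mul_assoc]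
      _ = _ := by
          rw [inclusion_transpose_mul]
          simp only [Matrix.mul_assoc, Matrix.mul_one]
  rw [extend, extend, extend, add_mul, one_mul, mul_add, mul_one, key, add_assoc, ← Matrix.add_mul,
    ← Matrix.mul_add, ← Matrix.add_mul, ← Matrix.mul_add]
  congr 4
  noncomm_ring

theorem extend_transpose {A : Type} [CommRing A] (h : Matrix (Fin 2) (Fin 2) A) :
    (extend hn h)ᵀ = extend hn hᵀ := by
  simp [extend, Matrix.transpose_mul, Matrix.mul_assoc]

theorem extend_mulVec {A : Type} [CommRing A] (h : Matrix (Fin 2) (Fin 2) A) (y : Fin 2 → A) :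
    extend hn h *ᵥ (inclusion hn A *ᵥ y) = inclusion hn A *ᵥ (h *ᵥ y) := by
  rw [extend, Matrix.add_mulVec, Matrix.one_mulVec, ← Matrix.mulVec_mulVec, ← Matrix.mulVec_mulVec,
    inclusion_transpose_mulVec, Matrix.sub_mulVec, Matrix.one_mulVec, Matrix.mulVec_sub]
  abel

theorem extend_one {A : Type} [CommRing A] : extend hn (1 : Matrix (Fin 2) (Fin 2) A) = 1 := by
  simp [extend]

theorem extend_map {A B : Type} [CommRing A] [CommRing B] (f : A →+* B)
    (h : Matrix (Fin 2) (Fin 2) A) : (extend hn h).map f = extend hn (h.map f) := by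
  rw [extend, extend, Matrix.map_add f (map_add f), Matrix.map_mul, Matrix.map_mul,
    Matrix.transpose_map, inclusion_map, Matrix.map_sub f (map_sub f)]
  simp

/-- The symplectic automorphism that acts on the plane by an invertible integral matrix. -/
def leviElement {g h : Matrix (Fin 2) (Fin 2) ℤ} (hgh : h * g = 1) : GZ n :=
  ⟨Matrix.fromBlocks (extend hn gᵀ) 0 0 (extend hn h), by
    have h1 : g * h = 1 := mul_eq_one_comm.1 hgh
    rw [SymplecticGroup.mem_iff, Matrix.J, Matrix.fromBlocks_transpose, Matrix.fromBlocks_multiply,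
      Matrix.fromBlocks_multiply]
    simp [extend_transpose, extend_mul, hgh, extend_one, ← Matrix.transpose_mul]⟩

theorem leviElement_mulVec {g h : Matrix (Fin 2) (Fin 2) ℤ} (hgh : h * g = 1) (y : Fin 2 → ℝ) :
    cast ℝ (leviElement hn hgh) *ᵥ planeVec hn y =
      planeVec hn (h.map (Int.castRingHom ℝ) *ᵥ y) := by
  rw [cast, leviElement, Matrix.fromBlocks_map, Matrix.fromBlocks_mulVec, planeVec, extend_map,
    extend_map]
  have h0 : (Sum.elim 0 (inclusion hn ℝ *ᵥ y) : H n ℝ) ∘ Sum.inl = 0 := rfl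
  have h1 : (Sum.elim 0 (inclusion hn ℝ *ᵥ y) : H n ℝ) ∘ Sum.inr = inclusion hn ℝ *ᵥ y := rfl
  rw [h0, h1, extend_mulVec, planeVec]
  simp only [Matrix.mulVec_zero, Matrix.map_zero, map_zero, Matrix.zero_mulVec, zero_add]

theorem leviElement_mem_stab {g h : Matrix (Fin 2) (Fin 2) ℤ} (hgh : h * g = 1) :
    leviElement hn hgh ∈ stab ⊤ (plane hn) := by
  refine ⟨Subgroup.mem_top _, ?_⟩
  change (plane hn).map (Matrix.toLin' (cast ℝ (leviElement hn hgh))) = plane hn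
  ext v
  simp only [Submodule.mem_map, mem_plane, Matrix.toLin'_apply]
  constructor
  · rintro ⟨_, ⟨y, rfl⟩, rfl⟩
    exact ⟨_, leviElement_mulVec hn hgh y⟩
  · rintro ⟨y, rfl⟩
    refine ⟨_, ⟨g.map (Int.castRingHom ℝ) *ᵥ y, rfl⟩, ?_⟩
    rw [leviElement_mulVec, Matrix.mulVec_mulVec, ← Matrix.map_mul, hgh]
    simp

/-- The integral base change found by reduction is realized on the plane by `leviElement`, so the
reduced expression of `X` is an expression in the generators of a translate of `σ₀`. -/
theorem etaPos_subset : etaPos (plane hn) ⊆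
    ⋃ σ ∈ SigmaS hn ⊤, (σ : Set (Mat n ℝ)) ∩ etaPos (plane hn) := by
  intro N hN
  obtain ⟨X, hX, rfl⟩ := (bijOn_etaPos hn).surjOn hN
  obtain ⟨g, h, -, hgh, a, ha, hXa⟩ := exists_reduction hX
  refine Set.mem_biUnion (x := (sigmaZero hn).translate (leviElement hn hgh))
    ⟨_, leviElement_mem_stab hn hgh, _, PointedCone.IsFaceOf.rfl, rfl⟩ ⟨?_, hN⟩
  refine (mem_translate_sigmaZero hn).2 ⟨a, ha, ?_⟩
  change symEquivₗ hn X = _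
  rw [hXa, map_sum]
  refine Finset.sum_congr rfl fun k _ => ?_
  rw [map_smul, genVec, leviElement_mulVec, ← symEquiv_vecMulVec]
  rfl

theorem sigmaZero_subset_closure : (sigmaZero hn : Set (Mat n ℝ)) ⊆ closure (etaPos (plane hn)) := by
  intro N hN
  obtain ⟨a, ha, rfl⟩ := (mem_sigmaZero hn).1 hN
  let Y : Matrix (Fin 2) (Fin 2) ℝ := ∑ k, a k • Matrix.vecMulVec (minVec ℝ k) (minVec ℝ k)
  have hY : Y.PosSemidef := Matrix.posSemidef_sum _ fun k _ =>
    (by simpa using Matrix.posSemidef_vecMulVec_self_star (minVec ℝ k) :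
      (Matrix.vecMulVec (minVec ℝ k) (minVec ℝ k)).PosSemidef).smul (ha k)
  have hNY : ∑ k, a k • rankOne (genVec hn ℝ k) = symEquivₗ hn Y := by
    rw [map_sum]
    refine Finset.sum_congr rfl fun k _ => ?_
    rw [map_smul, genVec, ← symEquiv_vecMulVec]
    rfl
  rw [hNY]
  -- The Gram matrix is only positive semidefinite on the cone; adding `t • 1` with `t > 0` makes it
  -- definite, and `t` tends to zero.
  have hcont : Continuous fun t : ℝ => symEquivₗ hn (t • 1 + Y) := by
    have := (symEquivₗ hn).continuous_of_finiteDimensional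
    fun_prop
  have hlim : Filter.Tendsto (fun t : ℝ => symEquivₗ hn (t • 1 + Y)) (nhdsWithin 0 (Set.Ioi 0))
      (nhds (symEquivₗ hn Y)) := by
    have := (hcont.tendsto 0).mono_left (nhdsWithin_le_nhds (s := Set.Ioi 0))
    simpa using this
  refine mem_closure_of_tendsto hlim (eventually_nhdsWithin_of_forall fun t ht => ?_)
  exact (bijOn_etaPos hn).mapsTo ((Matrix.PosDef.one.smul ht).add_posSemidef hY)

theorem Ad_mem_etaPos {γ : GZ n} {S : Submodule ℝ (H n ℝ)} (hγ : γ ∈ stab ⊤ S) {N : Mat n ℝ}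
    (hN : N ∈ etaPos S) : Ad γ N ∈ etaPos S := by
  have hS : ∀ s ∈ S, cast ℝ γ *ᵥ s ∈ S := by
    intro s hs
    have := Submodule.mem_map_of_mem (f := Matrix.toLin' (toReal γ)) hs
    rwa [hγ.2] at this
  refine ⟨⟨?_, fun v => ?_⟩, fun v hv => ?_⟩
  · rw [Ad_eq]
    exact conj_mem_g γ hN.1.1
  · rw [Ad_mulVec]
    exact hS _ (hN.1.2 _)
  · rw [Q_Ad]
    refine hN.2 _ fun h => hv fun s hs => ?_
    have h1 : cast ℝ γ⁻¹ *ᵥ s ∈ S := by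
      rw [← hγ.2] at hs
      obtain ⟨t, ht, rfl⟩ := hs
      change cast ℝ γ⁻¹ *ᵥ (cast ℝ γ *ᵥ t) ∈ S
      rwa [cast_inv_mulVec]
    rw [← Q_mulVec_mulVec (cast_mem γ⁻¹)]
    exact h _ h1

theorem isAdmissibleDecomposition :
    IsAdmissibleDecomposition ⊤ (plane hn) (SigmaS hn ⊤) where
  isFan := isFan_faceTranslates hn ⟨1, Subgroup.one_mem _⟩
  subset_closure := by
    rintro _ ⟨γ, hγ, τ, hτ, rfl⟩ _ ⟨N, hN, rfl⟩
    have hc : Continuous (Ad γ) := (Ad γ).continuous_of_finiteDimensional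
    exact map_mem_closure hc (sigmaZero_subset_closure hn (hτ.le hN))
      fun M hM => Ad_mem_etaPos hγ hM
  translate_mem := by
    rintro _ ⟨γ, hγ, τ, hτ, rfl⟩ δ hδ
    exact ⟨δ * γ, mul_mem hδ hγ, τ, hτ, (translate_mul δ γ τ).symm⟩
  finite_orbits := by
    refine ⟨{τ | PointedCone.IsFaceOf τ (sigmaZero hn)}, ?_, fun τ hτ => ?_, ?_⟩
    · rw [sigmaZero_eq]
      exact finite_faces _
    · exact ⟨1, one_mem _, τ, hτ, (translate_one τ).symm⟩
    · rintro _ ⟨γ, hγ, τ, hτ, rfl⟩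
      refine ⟨γ⁻¹, inv_mem hγ, ?_⟩
      rw [translate_inv_translate]
      exact hτ
  covers := (etaPos_subset hn).antisymm (Set.iUnion₂_subset fun _ _ => Set.inter_subset_right)

end Decomposition

/-! ### Complexification -/

section Complexification

variable {n : ℕ}

theorem ext_Q {A : Type} [CommRing A] {v w : H n A} (h : ∀ u, Q u v = Q u w) : v = w := by
  ext (i | i)
  · simpa [Q_single_inr] using h (Pi.single (Sum.inr i) 1)
  · simpa [Q_single_inl] using h (Pi.single (Sum.inl i) 1)

/-- A vector of `H_ℝ` as a vector of `H_ℂ`. -/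
def ofRealVec (x : H n ℝ) : H n ℂ := Complex.ofRealHom ∘ x

theorem eq_re_add_im (v : H n ℂ) :
    v = ofRealVec (fun i => (v i).re) + Complex.I • ofRealVec (fun i => (v i).im) := by
  ext i
  simp only [ofRealVec, Pi.add_apply, Pi.smul_apply, Function.comp_apply, smul_eq_mul,
    Complex.ofRealHom_eq_coe]
  rw [mul_comm]
  exact (Complex.re_add_im (v i)).symm

theorem star_eq_re_sub_im (v : H n ℂ) :
    star v = ofRealVec (fun i => (v i).re) - Complex.I • ofRealVec (fun i => (v i).im) := by
  ext i
  apply Complex.ext <;> simp [ofRealVec]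

theorem toComplex_mulVec_ofRealVec (N : Mat n ℝ) (x : H n ℝ) :
    toComplex N *ᵥ ofRealVec x = ofRealVec (N *ᵥ x) := by
  ext i
  simp only [ofRealVec, Function.comp_apply, RingHom.map_mulVec]
  rfl

theorem Q_ofRealVec (x y : H n ℝ) : Q (ofRealVec x) (ofRealVec y) = ((Q x y : ℝ) : ℂ) := by
  rw [Q_apply, Q_apply]
  simp [ofRealVec, dotProduct]

theorem star_toComplex_mulVec (N : Mat n ℝ) (v : H n ℂ) :
    star (toComplex N *ᵥ v) = toComplex N *ᵥ star v := by
  ext i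
  simp [toComplex, Matrix.mulVec, dotProduct]

theorem toComplex_mem_g {N : Mat n ℝ} (hN : N ∈ g n ℝ) : toComplex N ∈ g n ℂ :=
  map_mem_g (algebraMap ℝ ℂ) hN

theorem toComplex_mul (M N : Mat n ℝ) : toComplex (M * N) = toComplex M * toComplex N := by
  simp only [toComplex, Matrix.map_mul]

theorem toComplex_zero : toComplex (0 : Mat n ℝ) = 0 := by simp [toComplex]

theorem mem_conj {V : Submodule ℂ (H n ℂ)} {v : H n ℂ} : v ∈ conj V ↔ star v ∈ V := Iff.rfl

theorem Q_symm_of_mem_g {A : Type} [CommRing A] {N : Mat n A} (hN : N ∈ g n A) (v w : H n A) :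
    Q v (N *ᵥ w) = Q w (N *ᵥ v) := by
  rw [Q_swap, Q_mulVec_left hN, neg_neg]

/-- The form `φ_N` extended to a Hermitian form. -/
theorem re_Q_star {N : Mat n ℝ} (v : H n ℂ) :
    (Q v (toComplex N *ᵥ star v)).re =
      Q (fun i => (v i).re) (N *ᵥ fun i => (v i).re) +
        Q (fun i => (v i).im) (N *ᵥ fun i => (v i).im) := by
  have h : Q v (toComplex N *ᵥ star v) =
      Q (ofRealVec (fun i => (v i).re) + Complex.I • ofRealVec (fun i => (v i).im))
        (toComplex N *ᵥ
          (ofRealVec (fun i => (v i).re) - Complex.I • ofRealVec (fun i => (v i).im))) := by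
    rw [← eq_re_add_im, ← star_eq_re_sub_im]
  rw [h, sub_eq_add_neg, ← neg_smul, Matrix.mulVec_add, Matrix.mulVec_smul,
    toComplex_mulVec_ofRealVec, toComplex_mulVec_ofRealVec]
  simp only [Q_add_left, Q_add_right, Q_smul_left, Q_smul_right, Q_ofRealVec]
  simp

/-- An isotropic vector of a positive semidefinite form `φ_N` is in the kernel. -/
theorem mulVec_eq_zero_of_Q_eq_zero {N : Mat n ℝ} (hN : N ∈ g n ℝ)
    (hpos : ∀ v, 0 ≤ Q v (N *ᵥ v)) {x : H n ℝ} (hx : Q x (N *ᵥ x) = 0) : N *ᵥ x = 0 := by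
  refine ext_Q fun w => ?_
  rw [Q_zero_right]
  have h : ∀ t : ℝ, 0 ≤ Q w (N *ᵥ w) + 2 * t * Q w (N *ᵥ x) := by
    intro t
    have := hpos (w + t • x)
    simp only [Matrix.mulVec_add, Matrix.mulVec_smul, Q_add_left, Q_add_right, Q_smul_left,
      Q_smul_right, hx, Q_symm_of_mem_g hN x w] at this
    linarith
  by_contra hne
  -- Since `x` is isotropic, `φ_N(w + t x)` is affine in `t`. If its slope were nonzero, this `t`
  -- would give it the value `-1`.
  have := h (-(Q w (N *ᵥ w) + 1) / (2 * Q w (N *ᵥ x)))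
  have e : 2 * (-(Q w (N *ᵥ w) + 1) / (2 * Q w (N *ᵥ x))) * Q w (N *ᵥ x) =
      -(Q w (N *ᵥ w) + 1) := by
    field_simp
  rw [e] at this
  linarith

theorem toComplex_mulVec_eq_zero_iff {N : Mat n ℝ} {v : H n ℂ} :
    toComplex N *ᵥ v = 0 ↔ N *ᵥ (fun i => (v i).re) = 0 ∧ N *ᵥ (fun i => (v i).im) = 0 := by
  conv_lhs => rw [eq_re_add_im v]
  rw [Matrix.mulVec_add, Matrix.mulVec_smul, toComplex_mulVec_ofRealVec,
    toComplex_mulVec_ofRealVec]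
  constructor
  · intro h
    constructor <;> ext i
    · simpa [ofRealVec] using congrArg Complex.re (congrFun h i)
    · simpa [ofRealVec] using congrArg Complex.im (congrFun h i)
  · rintro ⟨h1, h2⟩
    rw [h1, h2]
    ext i
    simp [ofRealVec]

/-- The image of an element of the Lie algebra is the orthogonal complement of its kernel. -/
theorem mem_range_iff_orthogonal {A : Type} [Field A] {N : Mat n A} (hN : N ∈ g n A) {v : H n A} :
    v ∈ LinearMap.range (Matrix.toLin' N) ↔ ∀ w, N *ᵥ w = 0 → Q v w = 0 := by
  constructor
  · rintro ⟨u, rfl⟩ w hw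
    rw [Matrix.toLin'_apply, Q_mulVec_left hN, hw, Q_zero_right, neg_zero]
  · intro h
    let φ : Module.Dual A (H n A) :=
      { toFun := fun w => Q v w
        map_add' := fun _ _ => Q_add_right _ _ _
        map_smul' := fun c w => Q_smul_right c v w }
    -- The functional `Q(v, ·)` kills the kernel of `N`, so it factors as `ψ ∘ N`; representing `ψ`
    -- by a vector `u` then exhibits `v` as `N (-u)`.
    have hφ : φ ∈ (LinearMap.ker (Matrix.toLin' N)).dualAnnihilator := by
      rw [Submodule.mem_dualAnnihilator]
      intro w hw
      exact h w (by simpa using hw)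
    rw [← LinearMap.range_dualMap_eq_dualAnnihilator_ker] at hφ
    obtain ⟨ψ, hψ⟩ := hφ
    let u : H n A := Matrix.J (Fin n) A *ᵥ fun i => ψ (Pi.single i 1)
    have hu : ∀ w, Q u w = ψ w := by
      intro w
      have h1 : ψ w = ∑ i, w i * ψ (Pi.single i 1) := by
        conv_lhs => rw [pi_eq_sum_univ' w]
        simp [map_sum]
      rw [h1, Q_swap, Q, Matrix.mulVec_mulVec, Matrix.J_squared, Matrix.neg_mulVec,
        Matrix.one_mulVec, dotProduct_neg, neg_neg]
      rfl
    refine ⟨-u, ?_⟩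
    rw [Matrix.toLin'_apply]
    refine ext_Q fun w => ?_
    have h2 : Q v w = Q u (N *ᵥ w) := by
      rw [hu]
      exact (LinearMap.congr_fun hψ w).symm
    rw [Matrix.mulVec_neg, Q_swap w v, h2, ← neg_one_smul A, Q_smul_right, Q_symm_of_mem_g hN]
    ring

theorem exp_eq_one_add {M : Mat n ℂ} (h : M * M = 0) : NormedSpace.exp M = 1 + M := by
  rw [NormedSpace.exp_eq_tsum ℂ]
  simp only
  rw [tsum_eq_sum (s := Finset.range 2)]
  · simp [Finset.sum_range_succ]
  · intro k hk
    obtain ⟨m, rfl⟩ := Nat.exists_eq_add_of_le (not_lt.1 (Finset.mem_range.not.1 hk))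
    rw [pow_add, pow_two, h, zero_mul, smul_zero]

end Complexification

/-! ### Orbits of positive square-zero cones are of even type -/

section EvenOrbit

variable {n : ℕ}

/-- Cones in the Lie algebra all of whose products vanish and all of whose forms `φ_N` are positive
semidefinite. -/
structure IsPositiveSquareZero (σ : Cone n) : Prop where
  mem_g : ∀ N ∈ σ, N ∈ g n ℝ
  mul_eq_zero : ∀ M ∈ σ, ∀ N ∈ σ, M * N = 0
  nonneg : ∀ N ∈ σ, ∀ v, 0 ≤ Q v (N *ᵥ v)

theorem I_zpow_of_odd {p : ℤ} (hp : Odd p) : Complex.I ^ (2 * p + 1) = -Complex.I := by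
  obtain ⟨m, rfl⟩ := hp
  have : 2 * (2 * m + 1) + 1 = 4 * m + 3 := by ring
  rw [this, zpow_add₀ Complex.I_ne_zero, zpow_mul]
  have h4 : Complex.I ^ (4 : ℤ) = 1 := by exact_mod_cast Complex.I_pow_four
  have h3 : Complex.I ^ (3 : ℤ) = -Complex.I := by exact_mod_cast Complex.I_pow_three
  rw [h4, h3, one_zpow, one_mul]

/-- The vanishing of the odd part of weight zero of the limiting mixed Hodge structure. -/
theorem eq_zero_of_odd {h : HodgeNumbers n} {F : Filt n} (hF : CompactDual h F) {N : Mat n ℝ}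
    (hg : N ∈ g n ℝ) (hsq : N * N = 0) (hpos : ∀ v, 0 ≤ Q v (N *ᵥ v))
    (htr : ∀ p, ∀ v ∈ F p, toComplex N *ᵥ v ∈ F (p - 1)) {R : ℝ}
    (hD : ∀ y : ℝ, R < y → PeriodDomain h (F.map (1 + (Complex.I * (y : ℂ)) • toComplex N)))
    {p : ℤ} (hp : Odd p) {a b : H n ℂ} (hv : a + b ∈ F p) (ha : star a ∈ F (-p))
    (hb : star b ∈ F (-p - 1)) (hbN : b ∈ LinearMap.range (Matrix.toLin' (toComplex N))) :
    a + b = 0 := by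
  by_contra hne
  have hg' := toComplex_mem_g hg
  have hsq' : ∀ u, toComplex N *ᵥ (toComplex N *ᵥ u) = 0 := by
    intro u
    rw [Matrix.mulVec_mulVec, ← toComplex_mul, hsq, toComplex_zero, Matrix.zero_mulVec]
  have hNb : toComplex N *ᵥ star b = 0 := by
    obtain ⟨c, rfl⟩ := hbN
    rw [Matrix.toLin'_apply, star_toComplex_mulVec, hsq']
  set v := a + b with hvdef
  have hstar : star v = star a + star b := star_add a b
  -- The polarization inequality for `exp(iyN) v`. As `N² = 0`, the pairing is affine in `y`, and
  -- `i^{2p+1} = -i` for odd `p` gives the sign of the linear term.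
  have key : ∀ y : ℝ, R < y → 0 < (-Complex.I * Q v (star v)).re -
      2 * y * (Q v (toComplex N *ᵥ star v)).re := by
    intro y hy
    have hE : ∀ u, (1 + (Complex.I * (y : ℂ)) • toComplex N) *ᵥ u =
        u + (Complex.I * (y : ℂ)) • (toComplex N *ᵥ u) := fun u => by
      rw [Matrix.add_mulVec, Matrix.one_mulVec, Matrix.smul_mulVec]
    have hst : star (v + (Complex.I * (y : ℂ)) • (toComplex N *ᵥ v)) =
        star v + (-(Complex.I * (y : ℂ))) • (toComplex N *ᵥ star v) := by
      rw [star_add, star_smul, star_toComplex_mulVec]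
      simp
    have h1 := (hD y hy).positive p ((1 + (Complex.I * (y : ℂ)) • toComplex N) *ᵥ v)
      ⟨⟨v, hv, rfl⟩, ?_⟩ ?_
    · rw [I_zpow_of_odd hp, hE, hst] at h1
      have hQ : Q (v + (Complex.I * (y : ℂ)) • (toComplex N *ᵥ v))
          (star v + (-(Complex.I * (y : ℂ))) • (toComplex N *ᵥ star v)) =
          Q v (star v) - 2 * (Complex.I * y) * Q v (toComplex N *ᵥ star v) := by
        simp only [Q_add_left, Q_add_right, Q_smul_left, Q_smul_right, Q_mulVec_left hg', hsq',
          Q_zero_right]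
        ring
      rw [hQ] at h1
      have e : -Complex.I * (Q v (star v) - 2 * (Complex.I * y) * Q v (toComplex N *ᵥ star v)) =
          -Complex.I * Q v (star v) - ((2 * y : ℝ) : ℂ) * Q v (toComplex N *ᵥ star v) := by
        push_cast
        linear_combination (2 * y * Q v (toComplex N *ᵥ star v)) * Complex.I_mul_I
      rw [e, Complex.sub_re, Complex.re_ofReal_mul] at h1
      exact h1
    -- The vector `exp(-2iyN) (conj v)` is carried by `exp(iyN)` to `exp(-iyN) (conj v)`, the
    -- conjugate of `exp(iyN) v`. It lies in `F^{-p-1}` because `N (conj b) = 0` and `N` lowers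
    -- `F^{-p}` by one step.
    · refine ⟨star v + (-(2 * (Complex.I * (y : ℂ)))) • (toComplex N *ᵥ star v), ?_, ?_⟩
      · rw [hstar, Matrix.mulVec_add, hNb, add_zero]
        refine Submodule.add_mem _ (Submodule.add_mem _ ?_ hb) (Submodule.smul_mem _ _ (htr _ _ ha))
        exact hF.antitone (by omega) ha
      · rw [Matrix.toLin'_apply, hE, hE, hst, Matrix.mulVec_add, Matrix.mulVec_smul, hsq']
        module
    · intro h0
      rw [hE] at h0
      have h2 := congrArg (fun u => toComplex N *ᵥ u) h0
      simp only [Matrix.mulVec_add, Matrix.mulVec_smul, hsq', smul_zero, add_zero,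
        Matrix.mulVec_zero] at h2
      rw [h2, smul_zero, add_zero] at h0
      exact hne h0
  have hq := re_Q_star (N := N) v
  have hre := hpos (fun i => (v i).re)
  have him := hpos (fun i => (v i).im)
  -- A positive coefficient of `-2y` would violate the inequality once `y` exceeds both `R` and `c /
  -- (2q)`.
  have hq0 : (Q v (toComplex N *ᵥ star v)).re = 0 := by
    by_contra hq0
    have hqpos : 0 < (Q v (toComplex N *ᵥ star v)).re := lt_of_le_of_ne (by linarith) (Ne.symm hq0)
    set q := (Q v (toComplex N *ᵥ star v)).re
    set c := (-Complex.I * Q v (star v)).re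
    have h1 := key (max (R + 1) (c / (2 * q))) (lt_max_of_lt_left (by linarith))
    have h2 : c / (2 * q) ≤ max (R + 1) (c / (2 * q)) := le_max_right _ _
    rw [div_le_iff₀ (by positivity)] at h2
    linarith
  have hNv : toComplex N *ᵥ v = 0 := toComplex_mulVec_eq_zero_iff.2
    ⟨mulVec_eq_zero_of_Q_eq_zero hg hpos (by linarith),
      mulVec_eq_zero_of_Q_eq_zero hg hpos (by linarith)⟩
  -- `F^p` is orthogonal to `F^{-p}`, which contains `conj a`; and `conj b` lies in the image of
  -- `N`, which is orthogonal to its kernel, where `v` now lies.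
  have hQ0 : Q v (star v) = 0 := by
    rw [hstar, Q_add_right, hF.isotropic p v hv _ ha]
    obtain ⟨c, rfl⟩ := hbN
    rw [Matrix.toLin'_apply, star_toComplex_mulVec, ← neg_neg (Q v _), ← Q_mulVec_left hg', hNv,
      Q_zero_left, neg_zero, add_zero]
  have h1 := key (R + 1) (by linarith)
  rw [hQ0, hq0] at h1
  simp at h1

/-- The filtration `0 ⊆ Im N ⊆ Ker N ⊆ H` in degrees `-3, -2, -1, 0`. -/
noncomputable def squareZeroFiltration (N : Mat n ℂ) : Filt n := fun k =>
  if k ≤ -3 then ⊥ else if k = -2 then LinearMap.range (Matrix.toLin' N)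
    else if k = -1 then LinearMap.ker (Matrix.toLin' N) else ⊤

theorem squareZeroFiltration_of_le {N : Mat n ℂ} {k : ℤ} (hk : k ≤ -3) :
    squareZeroFiltration N k = ⊥ := by
  simp [squareZeroFiltration, hk]

theorem squareZeroFiltration_neg_two {N : Mat n ℂ} :
    squareZeroFiltration N (-2) = LinearMap.range (Matrix.toLin' N) := by
  simp [squareZeroFiltration]

theorem squareZeroFiltration_neg_one {N : Mat n ℂ} :
    squareZeroFiltration N (-1) = LinearMap.ker (Matrix.toLin' N) := by
  simp [squareZeroFiltration]

theorem squareZeroFiltration_of_nonneg {N : Mat n ℂ} {k : ℤ} (hk : 0 ≤ k) :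
    squareZeroFiltration N k = ⊤ := by
  rw [squareZeroFiltration, if_neg (by omega), if_neg (by omega), if_neg (by omega)]

theorem squareZeroFiltration_congr {M N : Mat n ℂ}
    (hr : LinearMap.range (Matrix.toLin' M) = LinearMap.range (Matrix.toLin' N))
    (hk : LinearMap.ker (Matrix.toLin' M) = LinearMap.ker (Matrix.toLin' N)) :
    squareZeroFiltration M = squareZeroFiltration N := by
  ext1 k
  simp only [squareZeroFiltration, hr, hk]

/-- The only nonzero graded pieces are `H / Ker N`, `Ker N / Im N` and `Im N`, in degrees `0`, `-1`,
`-2`, and `N` identifies the first with the last. For `m ≥ 2` both graded pieces vanish. -/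
theorem isWeightFiltration_squareZeroFiltration {N : Mat n ℂ} (hN : N * N = 0) :
    IsWeightFiltration N (squareZeroFiltration N) := by
  have hN' : ∀ v, N *ᵥ (N *ᵥ v) = 0 := fun v => by
    rw [Matrix.mulVec_mulVec, hN, Matrix.zero_mulVec]
  have hle : LinearMap.range (Matrix.toLin' N) ≤ LinearMap.ker (Matrix.toLin' N) := by
    rintro _ ⟨v, rfl⟩
    simpa using hN' v
  refine ⟨fun j k hjk => ?_, ⟨-3, squareZeroFiltration_of_le le_rfl⟩,
    ⟨0, squareZeroFiltration_of_nonneg le_rfl⟩, fun k v hv => ?_, fun m v hv hNv => ?_,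
    fun m w hw => ?_⟩
  · rcases le_or_gt j (-3) with hj | hj
    · rw [squareZeroFiltration_of_le hj]
      exact bot_le
    rcases le_or_gt 0 k with hk | hk
    · rw [squareZeroFiltration_of_nonneg hk]
      exact le_top
    obtain rfl | hj' : j = -2 ∨ j = -1 := by omega
    · obtain rfl | rfl : k = -2 ∨ k = -1 := by omega
      · exact le_rfl
      · rwa [squareZeroFiltration_neg_two, squareZeroFiltration_neg_one]
    · obtain rfl : k = j := by omega
      exact le_rfl
  · rcases le_or_gt k (-3) with hk | hk
    · rw [squareZeroFiltration_of_le hk, Submodule.mem_bot] at hv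
      rw [hv, Matrix.mulVec_zero]
      exact Submodule.zero_mem _
    rcases le_or_gt 2 k with hk2 | hk2
    · rw [squareZeroFiltration_of_nonneg (by omega)]
      trivial
    obtain rfl | rfl | rfl | rfl : k = -2 ∨ k = -1 ∨ k = 0 ∨ k = 1 := by omega
    · rw [squareZeroFiltration_neg_two] at hv
      have : N *ᵥ v = 0 := hle hv
      rw [this]
      exact Submodule.zero_mem _
    · rw [squareZeroFiltration_neg_one] at hv
      have : N *ᵥ v = 0 := hv
      rw [this]
      exact Submodule.zero_mem _
    · exact (squareZeroFiltration_neg_two (N := N)).symm ▸ ⟨v, rfl⟩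
    · exact (squareZeroFiltration_neg_one (N := N)).symm ▸ hle ⟨v, rfl⟩
  · obtain rfl | rfl | hm : m = 0 ∨ m = 1 ∨ 2 ≤ m := by omega
    · simpa using hNv
    · rw [squareZeroFiltration_of_le (by norm_num), Submodule.mem_bot, pow_one] at hNv
      exact (squareZeroFiltration_neg_one (N := N)).symm ▸ hNv
    · rw [squareZeroFiltration_of_nonneg (by omega)]
      trivial
  · obtain rfl | rfl | hm : m = 0 ∨ m = 1 ∨ 2 ≤ m := by omega
    · exact ⟨w, by simpa using hw, by simp⟩
    · have hw' : w ∈ squareZeroFiltration N (-2) := hw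
      rw [squareZeroFiltration_neg_two] at hw'
      obtain ⟨v, rfl⟩ := hw'
      refine ⟨v, ?_, ?_⟩
      · rw [squareZeroFiltration_of_nonneg (by norm_num)]
        trivial
      · simp
    · rw [squareZeroFiltration_of_le (by omega), Submodule.mem_bot] at hw
      exact ⟨0, Submodule.zero_mem _, by simp [hw]⟩

/-- A point of the relative interior of a convex set can be moved away from any other point. -/
theorem exists_add_smul_sub_mem {E : Type*} [AddCommGroup E] [Module ℝ E] [TopologicalSpace E]
    [IsTopologicalAddGroup E] [ContinuousSMul ℝ E] {s : Set E} {x y : E}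
    (hx : x ∈ intrinsicInterior ℝ s) (hy : y ∈ s) :
    ∃ t : ℝ, 0 < t ∧ x + t • (x - y) ∈ s := by
  obtain ⟨x, hx', rfl⟩ := mem_intrinsicInterior.1 hx
  have hmem : ∀ t : ℝ, (x : E) + t • ((x : E) - y) ∈ affineSpan ℝ s := by
    intro t
    have h2 := AffineMap.lineMap_mem (-t) x.2 (subset_affineSpan ℝ s hy)
    have e : AffineMap.lineMap (x : E) y (-t) = (x : E) + t • ((x : E) - y) := by
      rw [AffineMap.lineMap_apply_module]
      module
    rwa [e] at h2
  let f : ℝ → affineSpan ℝ s := fun t => ⟨(x : E) + t • ((x : E) - y), hmem t⟩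
  have hf : Continuous f := by
    refine Continuous.subtype_mk ?_ _
    fun_prop
  have h0 : f 0 = x := by
    apply Subtype.ext
    simp [f]
  have hnhds : f ⁻¹' ((↑) ⁻¹' s) ∈ nhds (0 : ℝ) := by
    apply hf.continuousAt.preimage_mem_nhds
    rw [h0]
    exact mem_interior_iff_mem_nhds.1 hx'
  obtain ⟨ε, hε, hball⟩ := Metric.mem_nhds_iff.1 hnhds
  refine ⟨ε / 2, by positivity, ?_⟩
  have := hball (show ε / 2 ∈ Metric.ball 0 ε by
    rw [Metric.mem_ball, Real.dist_eq, sub_zero, abs_of_pos (by positivity)]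
    linarith)
  exact this

/-- Elements of the relative interior have the smallest kernels. -/
theorem IsPositiveSquareZero.ker_le {σ : Cone n} (hσ : IsPositiveSquareZero σ) {M N : Mat n ℝ}
    (hM : M ∈ intrinsicInterior ℝ (σ : Set (Mat n ℝ))) (hN : N ∈ σ) {x : H n ℝ}
    (hx : M *ᵥ x = 0) : N *ᵥ x = 0 := by
  obtain ⟨t, ht, hmem⟩ := exists_add_smul_sub_mem hM hN
  refine mulVec_eq_zero_of_Q_eq_zero (hσ.mem_g N hN) (hσ.nonneg N hN)
    (le_antisymm ?_ (hσ.nonneg N hN x))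
  -- Moving from `M` past itself, away from `N`, stays in the cone. On the kernel of `M` the form of
  -- the new point is `-t φ_N` with `t > 0`, so `φ_N(x) ≤ 0`.
  have h1 := hσ.nonneg _ hmem x
  rw [Matrix.add_mulVec, Matrix.smul_mulVec, Matrix.sub_mulVec, hx, zero_add, zero_sub, smul_neg,
    ← neg_smul, Q_smul_right] at h1
  nlinarith

/-- The image is the orthogonal complement of the kernel, so the real kernel alone determines the
whole filtration. -/
theorem ker_range_eq_of_ker_iff {M N : Mat n ℝ} (hM : M ∈ g n ℝ) (hN : N ∈ g n ℝ)
    (h : ∀ x, M *ᵥ x = 0 ↔ N *ᵥ x = 0) :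
    squareZeroFiltration (toComplex M) = squareZeroFiltration (toComplex N) := by
  have h1 : ∀ v, toComplex M *ᵥ v = 0 ↔ toComplex N *ᵥ v = 0 := by
    intro v
    rw [toComplex_mulVec_eq_zero_iff, toComplex_mulVec_eq_zero_iff, h, h]
  refine squareZeroFiltration_congr ?_ ?_
  · ext v
    rw [mem_range_iff_orthogonal (toComplex_mem_g hM), mem_range_iff_orthogonal (toComplex_mem_g hN)]
    simp only [h1]
  · ext v
    exact h1 v

theorem map_algebraMap_rat (N : Mat n ℚ) :
    N.map (algebraMap ℚ ℂ) = toComplex (N.map (algebraMap ℚ ℝ)) := by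
  ext i j
  simp [toComplex]

/-- All nilpotent orbits of a positive square-zero cone are of even type. -/
theorem IsPositiveSquareZero.isEvenTypeOrbit {h : HodgeNumbers n} {σ : Cone n}
    (hσ : IsPositiveSquareZero σ) {F : Filt n} (hF : IsNilpotentOrbit h σ F) :
    IsEvenTypeOrbit σ F := by
  refine ⟨fun N hN => hσ.mul_eq_zero N hN N hN, ?_⟩
  obtain ⟨ℓ, N, hgen, R, hR⟩ := hF.mem_periodDomain
  have hmem : ∀ j, (N j).map (algebraMap ℚ ℝ) ∈ σ := fun j => by
    rw [← hgen.span_eq]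
    exact Submodule.subset_span ⟨j, rfl⟩
  -- By positivity, the kernel of the sum of the generators is the common kernel of all elements of
  -- `σ`. It therefore agrees with the kernel of every relative interior element, and the filtration
  -- of `M` serves for all of them.
  set M : Mat n ℝ := ∑ j, (N j).map (algebraMap ℚ ℝ) with hMdef
  have hM : M ∈ σ := Submodule.sum_mem _ fun j _ => hmem j
  have hMsq : M * M = 0 := hσ.mul_eq_zero M hM M hM
  have hMsq' : toComplex M * toComplex M = 0 := by rw [← toComplex_mul, hMsq, toComplex_zero]
  have hker : ∀ x, M *ᵥ x = 0 → ∀ N' ∈ σ, N' *ᵥ x = 0 := by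
    intro x hx N' hN'
    have hx0 : ∀ j, ((N j).map (algebraMap ℚ ℝ)) *ᵥ x = 0 := by
      intro j
      refine mulVec_eq_zero_of_Q_eq_zero (hσ.mem_g _ (hmem j)) (hσ.nonneg _ (hmem j)) ?_
      have h1 : ∑ j, Q x ((N j).map (algebraMap ℚ ℝ) *ᵥ x) = 0 := by
        rw [← Q_sum_right, ← Matrix.sum_mulVec, hx, Q_zero_right]
      exact (Finset.sum_eq_zero_iff_of_nonneg fun j _ => hσ.nonneg _ (hmem j) x).1 h1 j
        (Finset.mem_univ j)
    rw [← hgen.span_eq] at hN'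
    obtain ⟨a, -, rfl⟩ := mem_coneSpan_range.1 hN'
    rw [Matrix.sum_mulVec]
    exact Finset.sum_eq_zero fun j _ => by rw [Matrix.smul_mulVec, hx0, smul_zero]
  refine ⟨squareZeroFiltration (toComplex M), fun N' hN' => ?_, fun p hp => ?_⟩
  · have hN'σ : N' ∈ σ := intrinsicInterior_subset hN'
    rw [← ker_range_eq_of_ker_iff (hσ.mem_g N' hN'σ) (hσ.mem_g M hM)
      fun x => ⟨hσ.ker_le hN' hM, fun hx => hker x hx N' hN'σ⟩]
    refine isWeightFiltration_squareZeroFiltration ?_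
    rw [← toComplex_mul, hσ.mul_eq_zero N' hN'σ N' hN'σ, toComplex_zero]
  · rw [Submodule.eq_bot_iff]
    rintro v ⟨⟨hv, -⟩, hv'⟩
    -- The total weight is `p + (-p) = 0`, so the correction term for `j = 1` lies in `W_{-2} = Im
    -- M` and those for `j ≥ 2` lie in `W_{≤ -3} = 0`.
    have hle : (conj (F (-p)) ⊓ squareZeroFiltration (toComplex M) (p + -p) ⊔
        ⨆ (j : ℕ) (_ : 1 ≤ j), conj (F (-p - j)) ⊓
          squareZeroFiltration (toComplex M) (p + -p - j - 1)) ≤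
        conj (F (-p)) ⊔ conj (F (-p - 1)) ⊓ LinearMap.range (Matrix.toLin' (toComplex M)) := by
      refine sup_le (inf_le_left.trans le_sup_left) (iSup₂_le fun j hj => ?_)
      obtain rfl | hj' : j = 1 ∨ 2 ≤ j := by omega
      · refine le_trans (le_of_eq ?_) le_sup_right
        rw [← squareZeroFiltration_neg_two]
        congr 2
        push_cast
        ring
      · rw [squareZeroFiltration_of_le (by omega), inf_bot_eq]
        exact bot_le
    obtain ⟨a, ha, b, hb, rfl⟩ := Submodule.mem_sup.1 (hle hv')
    refine eq_zero_of_odd (R := R) hF.compactDual (hσ.mem_g M hM) hMsq (hσ.nonneg M hM)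
      (hF.transversal M hM) (fun y hy => ?_) hp hv ha hb.1 hb.2
    -- Equal parameters `x_j = y` reduce the orbit to the one-parameter orbit of `M`.
    have h1 := hR (fun _ => y) fun _ => hy
    have e : ∑ j, (Complex.I * (y : ℂ)) • (N j).map (algebraMap ℚ ℂ) =
        (Complex.I * (y : ℂ)) • toComplex M := by
      rw [← Finset.smul_sum, hMdef]
      congr 1
      simp only [map_algebraMap_rat]
      ext i j
      simp [toComplex, Matrix.sum_apply]
    rw [e, exp_eq_one_add (by rw [smul_mul_smul_comm, hMsq', smul_zero])] at h1
    exact h1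

theorem IsPositiveSquareZero.translate {σ : Cone n} (hσ : IsPositiveSquareZero σ) (γ : GZ n) :
    IsPositiveSquareZero (σ.translate γ) where
  mem_g := by
    rintro _ ⟨N, hN, rfl⟩
    change Ad γ N ∈ _
    rw [Ad_eq]
    exact conj_mem_g γ (hσ.mem_g N hN)
  mul_eq_zero := by
    rintro _ ⟨M, hM, rfl⟩ _ ⟨N, hN, rfl⟩
    change Ad γ M * Ad γ N = 0
    refine mat_ext fun v => ?_
    rw [← Matrix.mulVec_mulVec, Ad_mulVec, Ad_mulVec, cast_inv_mulVec, Matrix.mulVec_mulVec _ M,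
      hσ.mul_eq_zero M hM N hN]
    simp
  nonneg := by
    rintro _ ⟨N, hN, rfl⟩ v
    change 0 ≤ Q v (Ad γ N *ᵥ v)
    rw [Q_Ad]
    exact hσ.nonneg N hN _

theorem isPositiveSquareZero_of_le {σ τ : Cone n} (hσ : IsPositiveSquareZero σ) (h : τ ≤ σ) :
    IsPositiveSquareZero τ :=
  ⟨fun N hN => hσ.mem_g N (h hN), fun M hM N hN => hσ.mul_eq_zero M (h hM) N (h hN),
    fun N hN => hσ.nonneg N (h hN)⟩

theorem isPositiveSquareZero_sigmaZero (hn : 2 ≤ n) : IsPositiveSquareZero (sigmaZero hn) where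
  mem_g := by
    intro N hN
    obtain ⟨a, -, rfl⟩ := (mem_sigmaZero hn).1 hN
    exact (skewAdjointMatricesSubmodule (Matrix.J (Fin n) ℝ)).sum_mem fun k _ =>
      Submodule.smul_mem _ _ (rankOne_mem_g _)
  mul_eq_zero := by
    intro M hM N hN
    obtain ⟨a, -, rfl⟩ := (mem_sigmaZero hn).1 hM
    obtain ⟨b, -, rfl⟩ := (mem_sigmaZero hn).1 hN
    rw [Finset.sum_mul_sum]
    refine Finset.sum_eq_zero fun j _ => Finset.sum_eq_zero fun k _ => ?_
    rw [smul_mul_smul_comm, rankOne_mul_rankOne _ _ (Q_genVec_genVec hn _ _), smul_zero]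
  nonneg := by
    intro N hN v
    obtain ⟨a, ha, rfl⟩ := (mem_sigmaZero hn).1 hN
    rw [Q_sum_rankOne]
    exact Finset.sum_nonneg fun k _ => mul_nonneg (ha k) (sq_nonneg _)

end EvenOrbit

/-! ### Equivariance of nilpotent orbits -/

section Equivariance

variable {n : ℕ}

/-- The automorphism of `H_ℂ` given by `γ ∈ G_ℤ`. -/
def castEquiv (γ : GZ n) : H n ℂ ≃ₗ[ℂ] H n ℂ :=
  { Matrix.toLin' (cast ℂ γ) with
    invFun := fun v => cast ℂ γ⁻¹ *ᵥ v
    left_inv := cast_inv_mulVec γ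
    right_inv := cast_mulVec_inv γ }

theorem cast_eq_toComplex (γ : GZ n) : cast ℂ γ = toComplex (cast ℝ γ) :=
  (cast_map (algebraMap ℝ ℂ) γ).symm

theorem star_cast_mulVec (γ : GZ n) (v : H n ℂ) : star (cast ℂ γ *ᵥ v) = cast ℂ γ *ᵥ star v := by
  rw [cast_eq_toComplex, star_toComplex_mulVec]

theorem map_cast_eq (γ : GZ n) (F : Filt n) (p : ℤ) :
    F.map (cast ℂ γ) p = (F p).map (castEquiv γ : H n ℂ →ₗ[ℂ] H n ℂ) := rfl

theorem conj_map_cast (γ : GZ n) (V : Submodule ℂ (H n ℂ)) :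
    conj (V.map (castEquiv γ : H n ℂ →ₗ[ℂ] H n ℂ)) =
      (conj V).map (castEquiv γ : H n ℂ →ₗ[ℂ] H n ℂ) := by
  ext v
  constructor
  · rintro ⟨u, hu, huv⟩
    refine ⟨star u, ?_, ?_⟩
    · rw [SetLike.mem_coe, mem_conj, star_star]
      exact hu
    · change cast ℂ γ *ᵥ star u = v
      have huv : cast ℂ γ *ᵥ u = star v := huv
      rw [← star_cast_mulVec, huv, star_star]
  · rintro ⟨u, hu, rfl⟩
    exact ⟨star u, hu, (star_cast_mulVec γ u).symm⟩

theorem isCompl_map {V W : Submodule ℂ (H n ℂ)} (e : H n ℂ ≃ₗ[ℂ] H n ℂ) (h : IsCompl V W) :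
    IsCompl (V.map (e : H n ℂ →ₗ[ℂ] H n ℂ)) (W.map (e : H n ℂ →ₗ[ℂ] H n ℂ)) :=
  h.map (Submodule.orderIsoMapComap e)

theorem CompactDual.map_cast {h : HodgeNumbers n} {F : Filt n} (hF : CompactDual h F) (γ : GZ n) :
    CompactDual h (F.map (cast ℂ γ)) where
  antitone p q hpq := Submodule.map_mono (hF.antitone hpq)
  finrank_eq p := by
    rw [map_cast_eq, LinearEquiv.finrank_map_eq, hF.finrank_eq]
  isotropic := by
    rintro p _ ⟨v, hv, rfl⟩ _ ⟨w, hw, rfl⟩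
    rw [Matrix.toLin'_apply, Matrix.toLin'_apply, Q_mulVec_mulVec (cast_mem γ)]
    exact hF.isotropic p v hv w hw

theorem PeriodDomain.map_cast {h : HodgeNumbers n} {F : Filt n} (hF : PeriodDomain h F)
    (γ : GZ n) : PeriodDomain h (F.map (cast ℂ γ)) where
  compactDual := hF.compactDual.map_cast γ
  opposed p := by
    rw [map_cast_eq, map_cast_eq, conj_map_cast]
    exact isCompl_map _ (hF.opposed p)
  positive := by
    rintro p _ ⟨⟨v, hv, rfl⟩, hv'⟩ hv0
    have h1 : castEquiv γ v ∈ (conj (F (-p - 1))).map (castEquiv γ : H n ℂ →ₗ[ℂ] H n ℂ) := by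
      rw [← conj_map_cast]
      exact hv'
    obtain ⟨u, hu, huv⟩ := h1
    obtain rfl : u = v := (castEquiv γ).injective huv
    rw [Matrix.toLin'_apply, star_cast_mulVec, Q_mulVec_mulVec (cast_mem γ)]
    refine hF.positive p u ⟨hv, hu⟩ ?_
    rintro rfl
    exact hv0 (map_zero _)

theorem Filt.map_mul (A B : Mat n ℂ) (F : Filt n) : F.map (A * B) = (F.map B).map A := by
  ext1 p
  rw [Filt.map, Filt.map, Filt.map, Matrix.toLin'_mul, Submodule.map_comp]

theorem toComplex_Ad (γ : GZ n) (N : Mat n ℝ) :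
    toComplex (Ad γ N) = cast ℂ γ * toComplex N * cast ℂ γ⁻¹ := by
  rw [Ad_eq, toComplex_mul, toComplex_mul, cast_eq_toComplex, cast_eq_toComplex]

theorem IsNilpotentOrbit.translate {h : HodgeNumbers n} {σ : Cone n} {F : Filt n}
    (hF : IsNilpotentOrbit h σ F) (γ : GZ n) :
    IsNilpotentOrbit h (σ.translate γ) (F.map (cast ℂ γ)) where
  compactDual := hF.compactDual.map_cast γ
  mem_periodDomain := by
    obtain ⟨ℓ, N, hN, R, hR⟩ := hF.mem_periodDomain
    refine ⟨ℓ, _, hN.translate γ, R, fun x hx => ?_⟩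
    let u : (Mat n ℂ)ˣ := ⟨cast ℂ γ, cast ℂ γ⁻¹, cast_mul_inv γ, cast_inv_mul γ⟩
    have e : ∑ j, (Complex.I * (x j : ℂ)) •
        (cast ℚ γ * N j * cast ℚ γ⁻¹).map (algebraMap ℚ ℂ) =
        (u : Mat n ℂ) * (∑ j, (Complex.I * (x j : ℂ)) • (N j).map (algebraMap ℚ ℂ)) *
          ((u⁻¹ : (Mat n ℂ)ˣ) : Mat n ℂ) := by
      rw [Finset.mul_sum, Finset.sum_mul]
      refine Finset.sum_congr rfl fun j _ => ?_
      rw [Matrix.map_mul, Matrix.map_mul, cast_map, cast_map, mul_smul_comm, smul_mul_assoc]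
      rfl
    rw [e, Matrix.exp_units_conj, ← Filt.map_mul]
    have e2 : ∀ E : Mat n ℂ, (u : Mat n ℂ) * E * ((u⁻¹ : (Mat n ℂ)ˣ) : Mat n ℂ) * cast ℂ γ =
        cast ℂ γ * E := by
      intro E
      change cast ℂ γ * E * cast ℂ γ⁻¹ * cast ℂ γ = _
      rw [Matrix.mul_assoc _ (cast ℂ γ⁻¹), cast_inv_mul, Matrix.mul_one]
    rw [e2, Filt.map_mul]
    exact (hR x hx).map_cast γ
  transversal := by
    rintro _ ⟨N, hN, rfl⟩ p _ ⟨v, hv, rfl⟩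
    refine ⟨toComplex N *ᵥ v, hF.transversal N hN p v hv, ?_⟩
    change cast ℂ γ *ᵥ (toComplex N *ᵥ v) = toComplex (Ad γ N) *ᵥ (cast ℂ γ *ᵥ v)
    rw [toComplex_Ad, ← Matrix.mulVec_mulVec, ← Matrix.mulVec_mulVec, cast_inv_mulVec]

end Equivariance

/-! ### Hodge structures with prescribed Hodge numbers -/

section Existence

open scoped ComplexOrder

variable {n : ℕ}

/-- The vectors supported on a set of coordinates. -/
def coordSubmodule (s : Set (Fin n ⊕ Fin n)) : Submodule ℂ (H n ℂ) where
  carrier := {c | ∀ k, k ∉ s → c k = 0}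
  add_mem' ha hb k hk := by rw [Pi.add_apply, ha k hk, hb k hk, add_zero]
  zero_mem' _ _ := rfl
  smul_mem' r c hc k hk := by rw [Pi.smul_apply, hc k hk, smul_zero]

theorem mem_coordSubmodule {s : Set (Fin n ⊕ Fin n)} {c : H n ℂ} :
    c ∈ coordSubmodule s ↔ ∀ k, k ∉ s → c k = 0 := Iff.rfl

theorem coordSubmodule_mono {s t : Set (Fin n ⊕ Fin n)} (h : s ⊆ t) :
    coordSubmodule s ≤ coordSubmodule t := fun _ hc k hk => hc k fun hks => hk (h hks)

theorem coordSubmodule_eq_span (s : Set (Fin n ⊕ Fin n)) :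
    coordSubmodule s =
      Submodule.span ℂ (Set.range fun k : s => (Pi.basisFun ℂ (Fin n ⊕ Fin n)) k) := by
  ext c
  have : (Set.range fun k : s => (Pi.basisFun ℂ (Fin n ⊕ Fin n)) k) =
      Pi.basisFun ℂ (Fin n ⊕ Fin n) '' s := by
    rw [Set.image_eq_range]
  rw [this, Module.Basis.mem_span_image, mem_coordSubmodule]
  constructor
  · intro h k hk
    by_contra hks
    simp [h k hks] at hk
  · intro h k hk
    by_contra hc
    exact hk (h (by simpa using hc))

theorem finrank_coordSubmodule (s : Set (Fin n ⊕ Fin n)) [Fintype s] :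
    Module.finrank ℂ (coordSubmodule s) = Fintype.card s := by
  rw [coordSubmodule_eq_span]
  exact finrank_span_eq_card
    ((Pi.basisFun ℂ (Fin n ⊕ Fin n)).linearIndependent.comp _ Subtype.val_injective)

theorem isCompl_coordSubmodule (s : Set (Fin n ⊕ Fin n)) :
    IsCompl (coordSubmodule s) (coordSubmodule sᶜ) := by
  classical
  constructor
  · rw [Submodule.disjoint_def]
    intro c hc hc'
    ext k
    by_cases hk : k ∈ s
    · exact hc' k fun h => h hk
    · exact hc k hk
  · rw [codisjoint_iff, eq_top_iff]
    intro c _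
    refine Submodule.mem_sup.2 ⟨fun k => if k ∈ s then c k else 0, fun k hk => if_neg hk,
      fun k => if k ∈ s then 0 else c k, fun k hk => if_pos (not_not.1 hk), ?_⟩
    ext k
    by_cases hk : k ∈ s <;> simp [hk]

/-- The Hodge degrees of the coordinates: `d_j` for the `j`-th coordinate of the first half, and
`-d_j - 1` for the `j`-th coordinate of the second half. -/
def hodgeDegree (d : Fin n → ℤ) : Fin n ⊕ Fin n → ℤ := Sum.elim d fun j => -d j - 1

theorem hodgeDegree_swap (d : Fin n → ℤ) (k : Fin n ⊕ Fin n) :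
    hodgeDegree d k.swap = -hodgeDegree d k - 1 := by
  rcases k with k | k <;> simp [hodgeDegree]

/-- The matrix `K` with its `j`-th row multiplied by `(-1)^{d_j}`. -/
noncomputable def signed (d : Fin n → ℤ) (K : Matrix (Fin n) (Fin n) ℂ) :
    Matrix (Fin n) (Fin n) ℂ :=
  Matrix.diagonal (fun j => (-1 : ℂ) ^ d j) * K

theorem signed_apply (d : Fin n → ℤ) (K : Matrix (Fin n) (Fin n) ℂ) (i j : Fin n) :
    signed d K i j = (-1) ^ d i * K i j := by
  simp [signed, Matrix.diagonal_mul]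

/-- The coordinates on `H_ℂ` that are adapted to the Hodge structure given by `d` and `K`. -/
noncomputable def hodgeMap (d : Fin n → ℤ) (K : Matrix (Fin n) (Fin n) ℂ) :
    H n ℂ →ₗ[ℂ] H n ℂ where
  toFun c := Sum.elim (c ∘ Sum.inl + c ∘ Sum.inr)
    (-Complex.I • (signed d K *ᵥ (c ∘ Sum.inl - c ∘ Sum.inr)))
  map_add' b c := by
    have e : ∀ f : Fin n → Fin n ⊕ Fin n, (b + c) ∘ f = b ∘ f + c ∘ f := fun _ => rfl
    ext (i | i)
    · simp
      ring
    · simp only [e, Sum.elim_inr, Pi.add_apply, Pi.smul_apply, add_sub_add_comm, Matrix.mulVec_add,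
        smul_add]
  map_smul' r c := by
    have e : ∀ f : Fin n → Fin n ⊕ Fin n, (r • c) ∘ f = r • (c ∘ f) := fun _ => rfl
    ext (i | i)
    · simp
      ring
    · simp only [e, Sum.elim_inr, Pi.smul_apply, ← smul_sub, Matrix.mulVec_smul, RingHom.id_apply,
        smul_comm r]

theorem hodgeMap_apply (d : Fin n → ℤ) (K : Matrix (Fin n) (Fin n) ℂ) (c : H n ℂ) :
    hodgeMap d K c = Sum.elim (c ∘ Sum.inl + c ∘ Sum.inr)
      (-Complex.I • (signed d K *ᵥ (c ∘ Sum.inl - c ∘ Sum.inr))) := rfl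

/-- The data of a Hodge structure on `H` given by degrees and a positive definite real symmetric
matrix that respects the degrees. -/
structure IsHodgeDatum (d : Fin n → ℤ) (K : Matrix (Fin n) (Fin n) ℂ) : Prop where
  posDef : K.PosDef
  symm : Kᵀ = K
  block : ∀ i j, d i ≠ d j → K i j = 0

variable {d : Fin n → ℤ} {K : Matrix (Fin n) (Fin n) ℂ}

theorem neg_one_zpow_mul_self (p : ℤ) : (-1 : ℂ) ^ p * (-1) ^ p = 1 := by
  rw [← mul_zpow]
  simp

/-- The block condition keeps the signed matrix symmetric: a nonzero entry joins only rows carrying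
the same sign. -/
theorem IsHodgeDatum.signed_transpose (hK : IsHodgeDatum d K) : (signed d K)ᵀ = signed d K := by
  ext i j
  rw [Matrix.transpose_apply, signed_apply, signed_apply]
  have h1 : K j i = K i j := congrFun (congrFun hK.symm i) j
  rw [h1]
  by_cases h : d i = d j
  · rw [h]
  · rw [hK.block i j h, mul_zero, mul_zero]

theorem IsHodgeDatum.star_apply (hK : IsHodgeDatum d K) (i j : Fin n) : star (K i j) = K i j := by
  have h1 := congrFun (congrFun hK.posDef.isHermitian j) i
  have h2 := congrFun (congrFun hK.symm j) i
  rw [Matrix.conjTranspose_apply] at h1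
  rw [Matrix.transpose_apply] at h2
  rw [h1, ← h2]

theorem IsHodgeDatum.star_signed_mulVec (hK : IsHodgeDatum d K) (x : Fin n → ℂ) :
    star (signed d K *ᵥ x) = signed d K *ᵥ star x := by
  ext i
  simp only [Pi.star_apply, Matrix.mulVec, dotProduct, star_sum, star_mul', signed_apply,
    hK.star_apply]
  simp

theorem IsHodgeDatum.injective (hK : IsHodgeDatum d K) : Function.Injective (hodgeMap d K) := by
  rw [injective_iff_map_eq_zero]
  intro c hc
  rw [hodgeMap_apply] at hc
  have h1 : c ∘ Sum.inl + c ∘ Sum.inr = 0 := by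
    ext i
    simpa using congrFun hc (Sum.inl i)
  have h2 : signed d K *ᵥ (c ∘ Sum.inl - c ∘ Sum.inr) = 0 := by
    ext i
    simpa using congrFun hc (Sum.inr i)
  have h3 : K *ᵥ (c ∘ Sum.inl - c ∘ Sum.inr) = 0 := by
    have := congrArg (fun x => Matrix.diagonal (fun j => (-1 : ℂ) ^ d j) *ᵥ x) h2
    simp only [signed, Matrix.mulVec_mulVec, ← Matrix.mul_assoc, Matrix.diagonal_mul_diagonal,
      neg_one_zpow_mul_self, Matrix.mulVec_zero] at this
    simpa using this
  have h4 : c ∘ Sum.inl - c ∘ Sum.inr = 0 := by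
    have hu : IsUnit K := hK.posDef.isUnit
    exact (Matrix.mulVec_injective_iff_isUnit.2 hu) (by rw [h3, Matrix.mulVec_zero])
  ext (i | i)
  · have e1 := congrFun h1 i
    have e2 := congrFun h4 i
    simp only [Pi.add_apply, Pi.sub_apply, Function.comp_apply, Pi.zero_apply] at e1 e2 ⊢
    linear_combination (e1 + e2) / 2
  · have e1 := congrFun h1 i
    have e2 := congrFun h4 i
    simp only [Pi.add_apply, Pi.sub_apply, Function.comp_apply, Pi.zero_apply] at e1 e2 ⊢
    linear_combination (e1 - e2) / 2

/-- The adapted coordinates as an automorphism of `H_ℂ`. -/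
noncomputable def IsHodgeDatum.equiv (hK : IsHodgeDatum d K) : H n ℂ ≃ₗ[ℂ] H n ℂ :=
  LinearEquiv.ofInjectiveEndo (hodgeMap d K) hK.injective

theorem IsHodgeDatum.coe_equiv (hK : IsHodgeDatum d K) :
    (hK.equiv : H n ℂ →ₗ[ℂ] H n ℂ) = hodgeMap d K :=
  LinearMap.ext fun _ => rfl

/-- `signed d K` is real, so conjugation only changes the sign of `-i`, which is absorbed by
exchanging the two halves. Conjugate subspaces thereby become coordinate subspaces again. -/
theorem IsHodgeDatum.star_hodgeMap (hK : IsHodgeDatum d K) (c : H n ℂ) :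
    star (hodgeMap d K c) = hodgeMap d K (star c ∘ Sum.swap) := by
  have e1 : (star c ∘ Sum.swap) ∘ (Sum.inl : Fin n → Fin n ⊕ Fin n) = star (c ∘ Sum.inr) := rfl
  have e2 : (star c ∘ Sum.swap) ∘ (Sum.inr : Fin n → Fin n ⊕ Fin n) = star (c ∘ Sum.inl) := rfl
  rw [hodgeMap_apply, hodgeMap_apply, e1, e2, ← star_sub, ← hK.star_signed_mulVec,
    ← neg_sub (c ∘ Sum.inl), Matrix.mulVec_neg]
  ext (i | i)
  · simp [add_comm]
  · simp

/-- By symmetry of `signed d K` the products within the same half cancel, leaving only the pairing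
between the two halves. -/
theorem IsHodgeDatum.Q_hodgeMap (hK : IsHodgeDatum d K) (b c : H n ℂ) :
    Q (hodgeMap d K b) (hodgeMap d K c) =
      2 * Complex.I * ((b ∘ Sum.inr) ⬝ᵥ (signed d K *ᵥ (c ∘ Sum.inl)) -
        (b ∘ Sum.inl) ⬝ᵥ (signed d K *ᵥ (c ∘ Sum.inr))) := by
  have hs : ∀ x y : Fin n → ℂ, (signed d K *ᵥ x) ⬝ᵥ y = x ⬝ᵥ (signed d K *ᵥ y) := by
    intro x y
    rw [← Matrix.vecMul_transpose, hK.signed_transpose, ← Matrix.dotProduct_mulVec]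
  rw [Q_apply]
  simp only [hodgeMap_apply, Sum.elim_comp_inl, Sum.elim_comp_inr, smul_dotProduct,
    dotProduct_smul, hs, Matrix.mulVec_sub, add_dotProduct, sub_dotProduct,
    dotProduct_add, dotProduct_sub, smul_eq_mul]
  ring

/-- The Hodge filtration given by `d` and `K`. -/
noncomputable def hodgeFilt (d : Fin n → ℤ) (K : Matrix (Fin n) (Fin n) ℂ) : Filt n :=
  fun p => (coordSubmodule {k | p ≤ hodgeDegree d k}).map (hodgeMap d K)

theorem IsHodgeDatum.conj_map (hK : IsHodgeDatum d K) (s : Set (Fin n ⊕ Fin n)) :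
    conj ((coordSubmodule s).map (hodgeMap d K)) =
      (coordSubmodule (Sum.swap ⁻¹' s)).map (hodgeMap d K) := by
  ext v
  constructor
  · rintro ⟨c, hc, hcv⟩
    refine ⟨star c ∘ Sum.swap, fun k hk => ?_, ?_⟩
    · rw [Function.comp_apply, Pi.star_apply, hc _ hk, star_zero]
    · rw [← hK.star_hodgeMap, hcv, star_star]
  · rintro ⟨c, hc, rfl⟩
    refine ⟨star c ∘ Sum.swap, fun k hk => ?_, (hK.star_hodgeMap c).symm⟩
    rw [Function.comp_apply, Pi.star_apply, hc _ (by simpa using hk), star_zero]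

theorem IsHodgeDatum.dotProduct_signed_eq_zero (hK : IsHodgeDatum d K) {x y : Fin n → ℂ}
    (h : ∀ i j, x i ≠ 0 → y j ≠ 0 → d i ≠ d j) : x ⬝ᵥ (signed d K *ᵥ y) = 0 := by
  refine Finset.sum_eq_zero fun i _ => ?_
  by_cases hx : x i = 0
  · rw [hx, zero_mul]
  rw [Matrix.mulVec, dotProduct, Finset.sum_eq_zero, mul_zero]
  intro j _
  by_cases hy : y j = 0
  · rw [hy, mul_zero]
  · rw [signed_apply, hK.block i j (h i j hx hy), mul_zero, zero_mul]

theorem dotProduct_signed_eq {x : Fin n → ℂ} {p : ℤ} (h : ∀ i, x i ≠ 0 → d i = p)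
    (y : Fin n → ℂ) : x ⬝ᵥ (signed d K *ᵥ y) = (-1) ^ p * (x ⬝ᵥ (K *ᵥ y)) := by
  rw [dotProduct, dotProduct, Finset.mul_sum]
  refine Finset.sum_congr rfl fun i _ => ?_
  by_cases hx : x i = 0
  · rw [hx]
    ring
  · rw [signed, ← Matrix.mulVec_mulVec, Matrix.mulVec_diagonal, h i hx]
    ring

theorem I_zpow_two_mul_add_one (p : ℤ) : Complex.I ^ (2 * p + 1) = (-1) ^ p * Complex.I := by
  rw [zpow_add₀ Complex.I_ne_zero, zpow_mul, zpow_one]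
  congr 2
  exact_mod_cast Complex.I_sq

/-- The filtration given by `d` and `K` is a point of the period domain. -/
theorem IsHodgeDatum.periodDomain (hK : IsHodgeDatum d K) {h : HodgeNumbers n}
    (hd : ∀ r, (Finset.univ.filter fun k => hodgeDegree d k = r).card = h.h r) :
    PeriodDomain h (hodgeFilt d K) where
  compactDual :=
    { antitone := fun p q hpq =>
        Submodule.map_mono (coordSubmodule_mono fun k hk => hpq.trans hk)
      finrank_eq := fun p => by
        rw [hodgeFilt, ← hK.coe_equiv, LinearEquiv.finrank_map_eq, finrank_coordSubmodule]
        have h1 : Fintype.card {k | p ≤ hodgeDegree d k} =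
            (Finset.univ.filter fun k => p ≤ hodgeDegree d k).card := by
          rw [← Set.toFinset_card]
          congr 1
          ext k
          simp
        rw [h1, Finset.card_eq_sum_card_fiberwise (f := hodgeDegree d)
          (t := h.h.support.filter fun r => p ≤ r)]
        · refine Finset.sum_congr rfl fun r hr => ?_
          rw [← hd, Finset.filter_filter]
          congr 1
          ext k
          have := (Finset.mem_filter.1 hr).2
          simp only [Finset.mem_filter, Finset.mem_univ, true_and]
          constructor
          · exact fun h => h.2
          · rintro rfl
            exact ⟨this, rfl⟩
        · intro k hk
          have hk' : p ≤ hodgeDegree d k := by simpa using hk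
          simp only [Finset.coe_filter, Set.mem_ofPred_eq, Finsupp.mem_support_iff]
          refine ⟨?_, hk'⟩
          rw [← hd]
          exact (Finset.card_pos.2 ⟨k, by simp⟩).ne'
      isotropic := by
        rintro p _ ⟨b, hb, rfl⟩ _ ⟨c, hc, rfl⟩
        have hb' : ∀ k, b k ≠ 0 → p ≤ hodgeDegree d k := fun k hk => by
          by_contra hn
          exact hk (hb k hn)
        have hc' : ∀ k, c k ≠ 0 → -p ≤ hodgeDegree d k := fun k hk => by
          by_contra hn
          exact hk (hc k hn)
        rw [hK.Q_hodgeMap, hK.dotProduct_signed_eq_zero, hK.dotProduct_signed_eq_zero, sub_zero,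
          mul_zero]
        -- A nonzero entry would need equal degrees `d i = d j`, but the bounds from `F^p` and
        -- `F^{-p}` separate `d i` from `d j`.
        · intro i j hi hj
          have h1 := hb' _ hi
          have h2 := hc' _ hj
          simp only [hodgeDegree, Sum.elim_inl, Sum.elim_inr] at h1 h2
          omega
        · intro i j hi hj
          have h1 := hb' _ hi
          have h2 := hc' _ hj
          simp only [hodgeDegree, Sum.elim_inl, Sum.elim_inr] at h1 h2
          omega }
  opposed p := by
    rw [hodgeFilt, hodgeFilt, hK.conj_map, ← hK.coe_equiv]
    have e : Sum.swap ⁻¹' {k | -p ≤ hodgeDegree d k} = {k | p ≤ hodgeDegree d k}ᶜ := by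
      ext k
      simp only [Set.mem_preimage, Set.mem_ofPred_eq, Set.mem_compl_iff, hodgeDegree_swap]
      omega
    rw [e]
    exact isCompl_map _ (isCompl_coordSubmodule _)
  positive := by
    rintro p v ⟨hv, hv'⟩ hv0
    rw [SetLike.mem_coe, hodgeFilt, hK.conj_map] at hv'
    obtain ⟨c, hc, rfl⟩ := hv
    obtain ⟨c', hc', hcc⟩ := hv'
    obtain rfl : c' = c := hK.injective hcc
    -- Lying in both `F^p` and the conjugate of `F^{-p-1}` bounds the degree from both sides, as
    -- swapping the halves sends degree `k` to `-k-1`.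
    have hdeg : ∀ k, c' k ≠ 0 → hodgeDegree d k = p := by
      intro k hk
      have h1 : p ≤ hodgeDegree d k := by
        by_contra hn
        exact hk (hc k hn)
      have h2 : -p - 1 ≤ hodgeDegree d k.swap := by
        by_contra hn
        exact hk (hc' k hn)
      rw [hodgeDegree_swap] at h2
      omega
    set a : Fin n → ℂ := c' ∘ Sum.inl with ha
    set b : Fin n → ℂ := c' ∘ Sum.inr with hb
    have e1 : (star c' ∘ Sum.swap) ∘ (Sum.inl : Fin n → Fin n ⊕ Fin n) = star b := rfl
    have e2 : (star c' ∘ Sum.swap) ∘ (Sum.inr : Fin n → Fin n ⊕ Fin n) = star a := rfl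
    have hsa : a ⬝ᵥ (signed d K *ᵥ star a) = (-1) ^ p * (a ⬝ᵥ (K *ᵥ star a)) :=
      dotProduct_signed_eq (fun i hi => hdeg (Sum.inl i) hi) _
    -- In the second half degree `p` means `d = -p-1`, whose sign is opposite to `(-1)^p`. This
    -- offsets the minus sign in `Q_hodgeMap`, so both halves contribute positively.
    have hsb : b ⬝ᵥ (signed d K *ᵥ star b) = -(-1) ^ p * (b ⬝ᵥ (K *ᵥ star b)) := by
      rw [dotProduct_signed_eq (p := -p - 1) fun i hi => ?_]
      · congr 1
        rw [zpow_sub₀ (by norm_num), zpow_neg, zpow_one, div_neg, div_one, ← inv_zpow]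
        norm_num
      · have := hdeg (Sum.inr i) hi
        simp only [hodgeDegree, Sum.elim_inr] at this
        omega
    have hnn : ∀ x : Fin n → ℂ, 0 ≤ (x ⬝ᵥ (K *ᵥ star x)).re := by
      intro x
      have := hK.posDef.posSemidef.re_dotProduct_nonneg (star x)
      simpa using this
    have hpos : ∀ x : Fin n → ℂ, x ≠ 0 → 0 < (x ⬝ᵥ (K *ᵥ star x)).re := by
      intro x hx
      have := hK.posDef.re_dotProduct_pos (x := star x) (by simpa using hx)
      simpa using this
    rw [hK.star_hodgeMap, hK.Q_hodgeMap, e1, e2, ← ha, ← hb, hsa, hsb, I_zpow_two_mul_add_one]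
    have e : (-1) ^ p * Complex.I * (2 * Complex.I * (-(-1) ^ p * (b ⬝ᵥ (K *ᵥ star b)) -
        (-1) ^ p * (a ⬝ᵥ (K *ᵥ star a)))) =
        ((2 : ℝ) : ℂ) * (b ⬝ᵥ (K *ᵥ star b) + a ⬝ᵥ (K *ᵥ star a)) := by
      have h1 := neg_one_zpow_mul_self p
      push_cast
      linear_combination (-2 * (b ⬝ᵥ (K *ᵥ star b) + a ⬝ᵥ (K *ᵥ star a)) *
        ((-1) ^ p * (-1) ^ p)) * Complex.I_mul_I +
        2 * (b ⬝ᵥ (K *ᵥ star b) + a ⬝ᵥ (K *ᵥ star a)) * h1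
    rw [e, Complex.re_ofReal_mul, Complex.add_re]
    have hab : a ≠ 0 ∨ b ≠ 0 := by
      by_contra! hab
      apply hv0
      have : c' = 0 := by
        ext (i | i)
        · exact congrFun hab.1 i
        · exact congrFun hab.2 i
      rw [this, map_zero]
    rcases hab with h1 | h1
    · have := hpos a h1
      have := hnn b
      positivity
    · have := hpos b h1
      have := hnn a
      positivity

end Existence

/-! ### Existence of nilpotent orbits -/

section Orbits

open scoped ComplexOrder

variable {n : ℕ}

/-- The symmetry `p ↦ -p-1` exchanges nonnegative and negative `p`, so each of them carries half of
the total `2n`. -/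
theorem HodgeNumbers.sum_nonneg (h : HodgeNumbers n) :
    ∑ p ∈ h.h.support with 0 ≤ p, h.h p = n := by
  have h1 : ∑ p ∈ h.h.support with ¬ 0 ≤ p, h.h p = ∑ p ∈ h.h.support with 0 ≤ p, h.h p := by
    refine Finset.sum_nbij' (fun p => -p - 1) (fun p => -p - 1) ?_ ?_ ?_ ?_ ?_
    · intro p hp
      simp only [Finset.mem_filter, Finsupp.mem_support_iff, h.symm] at hp ⊢
      exact ⟨hp.1, by omega⟩
    · intro p hp
      simp only [Finset.mem_filter, Finsupp.mem_support_iff, h.symm] at hp ⊢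
      exact ⟨hp.1, by omega⟩
    · intro p _
      ring
    · intro p _
      ring
    · intro p _
      exact (h.symm p).symm
  have h2 := h.total
  rw [Finsupp.sum, ← Finset.sum_filter_add_sum_filter_not _ (fun p => 0 ≤ p), h1] at h2
  omega

/-- Hodge numbers are realized by a distribution of degrees over the coordinates for which the two
last coordinates have degree zero. -/
theorem HodgeNumbers.exists_degree (h : HodgeNumbers n) (h_two : 2 ≤ h.h 0) (hn : 2 ≤ n) :
    ∃ d : Fin n → ℤ, (∀ a, d (idx hn a) = 0) ∧
      ∀ r, (Finset.univ.filter fun k => hodgeDegree d k = r).card = h.h r := by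
  classical
  -- `h p` labelled copies of each `p ≥ 0`, which makes `n` elements in all; a bijection from the
  -- indices to `t` is a distribution of degrees.
  let t : Finset (Σ _ : ℤ, ℕ) :=
    (h.h.support.filter fun p => 0 ≤ p).sigma fun p => Finset.range (h.h p)
  have ht : Fintype.card (Fin n) = t.card := by
    rw [Finset.card_sigma]
    simp [h.sum_nonneg]
  let s : Finset (Fin n) := Finset.univ.image (idx hn)
  -- The last two indices go to the first two copies of degree zero, which exist because `h 0 ≥ 2`.
  -- Only the values on `s` matter; elsewhere the subtraction truncates.
  let f : Fin n → Σ _ : ℤ, ℕ := fun i => ⟨0, i - (n - 2)⟩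
  have hf0 : ∀ a, f (idx hn a) = ⟨0, a⟩ := by
    intro a
    simp [f, idx]
  have hst : s.image f ⊆ t := by
    intro x hx
    simp only [s, Finset.mem_image, Finset.mem_univ, true_and, exists_exists_eq_and] at hx
    obtain ⟨a, rfl⟩ := hx
    rw [hf0]
    simp only [t, Finset.mem_sigma, Finset.mem_filter, Finsupp.mem_support_iff, Finset.mem_range]
    exact ⟨⟨by omega, le_rfl⟩, by omega⟩
  have hinj : Set.InjOn f s := by
    intro i hi j hj hij
    simp only [s, Finset.coe_image, Set.mem_image, Finset.coe_univ, Set.mem_univ, true_and] at hi hj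
    obtain ⟨a, rfl⟩ := hi
    obtain ⟨b, rfl⟩ := hj
    rw [hf0, hf0] at hij
    simp only [Sigma.mk.injEq, heq_eq_eq, true_and] at hij
    rw [Fin.ext hij]
  obtain ⟨e, he⟩ := Finset.exists_equiv_extend_of_card_eq ht hst hinj
  have hcount : ∀ r, (Finset.univ.filter fun i => (e i).1.1 = r).card =
      if 0 ≤ r then h.h r else 0 := by
    intro r
    have h1 : (Finset.univ.filter fun i => (e i).1.1 = r).card =
        (t.filter fun x => x.1 = r).card := by
      refine Finset.card_bij (fun i _ => (e i).1) ?_ ?_ ?_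
      · intro i hi
        exact Finset.mem_filter.2 ⟨(e i).2, (Finset.mem_filter.1 hi).2⟩
      · intro i _ j _ hij
        exact e.injective (Subtype.ext hij)
      · intro x hx
        obtain ⟨hxt, hxr⟩ := Finset.mem_filter.1 hx
        exact ⟨e.symm ⟨x, hxt⟩, by simpa using hxr, by simp⟩
    rw [h1]
    split_ifs with hr
    · have h2 : (t.filter fun x => x.1 = r) =
          (Finset.range (h.h r)).image fun m => (⟨r, m⟩ : Σ _ : ℤ, ℕ) := by
        ext ⟨q, m⟩
        simp only [t, Finset.mem_filter, Finset.mem_sigma, Finsupp.mem_support_iff,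
          Finset.mem_range, Finset.mem_image, Sigma.mk.injEq, heq_eq_eq]
        constructor
        · rintro ⟨⟨-, hm⟩, rfl⟩
          exact ⟨m, hm, rfl, rfl⟩
        · rintro ⟨m, hm, rfl, rfl⟩
          exact ⟨⟨⟨by omega, hr⟩, hm⟩, rfl⟩
      rw [h2, Finset.card_image_of_injective, Finset.card_range]
      intro a b hab
      simpa using hab
    · rw [Finset.card_eq_zero, Finset.filter_eq_empty_iff]
      intro x hx hxr
      simp only [t, Finset.mem_sigma, Finset.mem_filter] at hx
      omega
  refine ⟨fun i => (e i).1.1, fun a => ?_, fun r => ?_⟩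
  · simp only [he _ (Finset.mem_image_of_mem _ (Finset.mem_univ a)), hf0]
  · have h0 : (Finset.univ.filter fun k => hodgeDegree (fun i => (e i).1.1) k = r) =
        (Finset.univ.filter fun i => (e i).1.1 = r).disjSum
          (Finset.univ.filter fun i => -(e i).1.1 - 1 = r) := by
      ext (i | i)
      · rw [Finset.mem_filter, Finset.inl_mem_disjSum, Finset.mem_filter]
        simp only [Finset.mem_univ, true_and]
        rfl
      · rw [Finset.mem_filter, Finset.inr_mem_disjSum, Finset.mem_filter]
        simp only [Finset.mem_univ, true_and]
        rfl
    rw [h0, Finset.card_disjSum, hcount]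
    have h1 : (Finset.univ.filter fun i => -(e i).1.1 - 1 = r) =
        Finset.univ.filter fun i => (e i).1.1 = -r - 1 := by
      ext i
      simp only [Finset.mem_filter, Finset.mem_univ, true_and]
      omega
    rw [h1, hcount, h.symm]
    split_ifs <;> omega

/-- The hypotheses on a positive semidefinite matrix that allow to add it to a Hodge datum. -/
structure IsShear (d : Fin n → ℤ) (Y : Matrix (Fin n) (Fin n) ℂ) : Prop where
  posSemidef : Y.PosSemidef
  symm : Yᵀ = Y
  support : ∀ i j, Y i j ≠ 0 → d i = 0 ∧ d j = 0

variable {d : Fin n → ℤ} {Y : Matrix (Fin n) (Fin n) ℂ}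

theorem IsShear.isHodgeDatum (hY : IsShear d Y) : IsHodgeDatum d (1 + Y) where
  posDef := Matrix.PosDef.one.add_posSemidef hY.posSemidef
  symm := by rw [Matrix.transpose_add, Matrix.transpose_one, hY.symm]
  block i j hij := by
    have h1 : i ≠ j := fun h => hij (by rw [h])
    rw [Matrix.add_apply, Matrix.one_apply_ne h1, zero_add]
    by_contra h
    have := hY.support i j h
    exact hij (this.1.trans this.2.symm)

theorem isHodgeDatum_one (d : Fin n → ℤ) : IsHodgeDatum d 1 where
  posDef := Matrix.PosDef.one
  symm := Matrix.transpose_one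
  block i j hij := Matrix.one_apply_ne fun h => hij (by rw [h])

theorem IsShear.signed_eq (hY : IsShear d Y) : signed d Y = Y := by
  ext i j
  rw [signed_apply]
  by_cases h : Y i j = 0
  · rw [h, mul_zero]
  · rw [(hY.support i j h).1, zpow_zero, one_mul]

theorem signed_add (K L : Matrix (Fin n) (Fin n) ℂ) :
    signed d (K + L) = signed d K + signed d L := by
  rw [signed, signed, signed, Matrix.mul_add]

/-- Adding `(x, -x)` keeps the sum of the two halves, which the shear does not change, and adds `2x`
to their difference. Matching the second components amounts to `(1 + Y) x = Y c_r`, with `c_r` the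
second half of `c`. -/
theorem IsShear.shear_hodgeMap (hY : IsShear d Y) (c : H n ℂ) {x : Fin n → ℂ}
    (hx : x + Y *ᵥ x = Y *ᵥ (c ∘ Sum.inr)) :
    (1 + Complex.I • Matrix.fromBlocks 0 0 (-Y) 0) *ᵥ hodgeMap d 1 c =
      hodgeMap d (1 + Y) (c + Sum.elim x (-x)) := by
  have e1 : (c + Sum.elim x (-x)) ∘ Sum.inl = c ∘ Sum.inl + x := rfl
  have e2 : (c + Sum.elim x (-x)) ∘ Sum.inr = c ∘ Sum.inr - x := by
    ext i
    simp [sub_eq_add_neg]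
  have hs : signed d (1 + Y) *ᵥ x = signed d 1 *ᵥ (Y *ᵥ (c ∘ Sum.inr)) := by
    rw [← hx, signed, signed, ← Matrix.mulVec_mulVec, Matrix.mul_one, Matrix.add_mulVec,
      Matrix.one_mulVec]
  have hY' : signed d 1 *ᵥ (Y *ᵥ (c ∘ Sum.inr)) = Y *ᵥ (c ∘ Sum.inr) := by
    rw [Matrix.mulVec_mulVec, signed, Matrix.mul_one]
    exact congrArg (· *ᵥ (c ∘ Sum.inr)) hY.signed_eq
  rw [hodgeMap_apply, hodgeMap_apply, e1, e2, Matrix.add_mulVec, Matrix.one_mulVec,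
    Matrix.smul_mulVec, Matrix.fromBlocks_mulVec]
  have e3 : c ∘ Sum.inl + x - (c ∘ Sum.inr - x) =
      (c ∘ Sum.inl - c ∘ Sum.inr) + ((2 : ℂ) • x) := by
    module
  rw [e3, Matrix.mulVec_add, Matrix.mulVec_smul, hs, hY', signed_add, hY.signed_eq,
    Matrix.add_mulVec]
  simp only [Sum.elim_comp_inl, Sum.elim_comp_inr, Matrix.zero_mulVec, add_zero, Matrix.neg_mulVec,
    Matrix.mulVec_add, Matrix.mulVec_sub]
  ext (i | i)
  · simp
  · simp only [Pi.add_apply, Sum.elim_inr, Pi.smul_apply, Pi.sub_apply, Pi.neg_apply, smul_eq_mul]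
    ring

theorem IsShear.mulVec_eq_zero (hY : IsShear d Y) {p : ℤ} (hp : 0 ≤ p) {c : H n ℂ}
    (hc : c ∈ coordSubmodule {k | p ≤ hodgeDegree d k}) : Y *ᵥ (c ∘ Sum.inr) = 0 := by
  ext i
  rw [Matrix.mulVec, dotProduct, Pi.zero_apply]
  refine Finset.sum_eq_zero fun j _ => ?_
  by_cases h : Y i j = 0
  · rw [h, zero_mul]
  · have h1 := (hY.support i j h).2
    rw [Function.comp_apply, hc (Sum.inr j), mul_zero]
    simp only [Set.mem_ofPred_eq, hodgeDegree, Sum.elim_inr]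
    omega

/-- The exponential of a shear maps the reference Hodge filtration to another one. -/
theorem IsShear.map_hodgeFilt (hY : IsShear d Y) :
    (hodgeFilt d 1).map (1 + Complex.I • Matrix.fromBlocks 0 0 (-Y) 0) =
      hodgeFilt d (1 + Y) := by
  ext1 p
  set E : Mat n ℂ := 1 + Complex.I • Matrix.fromBlocks 0 0 (-Y) 0 with hE
  have hle : (hodgeFilt d 1).map E p ≤ hodgeFilt d (1 + Y) p := by
    rintro _ ⟨_, ⟨c, hc, rfl⟩, rfl⟩
    have hu : IsUnit (1 + Y).det := by
      rw [← Matrix.isUnit_iff_isUnit_det]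
      exact hY.isHodgeDatum.posDef.isUnit
    set x := (1 + Y)⁻¹ *ᵥ (Y *ᵥ (c ∘ Sum.inr)) with hxdef
    have hx : x + Y *ᵥ x = Y *ᵥ (c ∘ Sum.inr) := by
      have : (1 + Y) *ᵥ x = Y *ᵥ (c ∘ Sum.inr) := by
        rw [hxdef, Matrix.mulVec_mulVec, Matrix.mul_nonsing_inv _ hu, Matrix.one_mulVec]
      rwa [Matrix.add_mulVec, Matrix.one_mulVec] at this
    refine ⟨c + Sum.elim x (-x), ?_, ?_⟩
    · refine Submodule.add_mem _ hc ?_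
      -- For `p ≥ 0` the correction vanishes, as the entries of degree `-1` do. For `p < 0` it is
      -- supported on indices with `d = 0`, of degrees `0` and `-1`, both at least `p`.
      rcases le_or_gt 0 p with hp | hp
      · have : x = 0 := by rw [hxdef, hY.mulVec_eq_zero hp hc, Matrix.mulVec_zero]
        intro k _
        rcases k with k | k <;> simp [this]
      · have hxi : ∀ i, d i ≠ 0 → x i = 0 := by
          intro i hi
          have h1 : x = Y *ᵥ (c ∘ Sum.inr - x) := by
            rw [Matrix.mulVec_sub, ← hx, add_sub_cancel_right]
          rw [h1, Matrix.mulVec, dotProduct]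
          refine Finset.sum_eq_zero fun j _ => ?_
          by_cases h : Y i j = 0
          · rw [h, zero_mul]
          · exact absurd (hY.support i j h).1 hi
        rintro (i | i) hk
        · refine hxi i fun h0 => hk ?_
          simp only [Set.mem_ofPred_eq, hodgeDegree, Sum.elim_inl]
          omega
        · rw [Sum.elim_inr, Pi.neg_apply, hxi i, neg_zero]
          intro h0
          apply hk
          simp only [Set.mem_ofPred_eq, hodgeDegree, Sum.elim_inr]
          omega
    · rw [Matrix.toLin'_apply, hE, hY.shear_hodgeMap c hx]
  -- The shear is invertible and both sides are images of the same coordinate subspace under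
  -- injective maps, so the inclusion is an equality by dimension.
  refine Submodule.eq_of_le_of_finrank_eq hle ?_
  have hinj : Function.Injective (Matrix.toLin' E) := by
    have h1 : (1 - Complex.I • Matrix.fromBlocks 0 0 (-Y) 0) * E = 1 := by
      rw [hE, sub_mul, one_mul, mul_add, mul_one, smul_mul_smul_comm, Matrix.fromBlocks_multiply]
      simp
    intro u v huv
    have := congrArg (fun w => (1 - Complex.I • Matrix.fromBlocks 0 0 (-Y) 0 : Mat n ℂ) *ᵥ w) huv
    simpa only [Matrix.toLin'_apply, Matrix.mulVec_mulVec, h1, Matrix.one_mulVec] using this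
  have f1 : ∀ V : Submodule ℂ (H n ℂ), Module.finrank ℂ (V.map (Matrix.toLin' E)) =
      Module.finrank ℂ V := fun V =>
    LinearEquiv.finrank_eq (Submodule.equivMapOfInjective _ hinj V).symm
  have f2 : ∀ {K : Matrix (Fin n) (Fin n) ℂ}, IsHodgeDatum d K →
      Module.finrank ℂ (hodgeFilt d K p) =
        Module.finrank ℂ (coordSubmodule {k | p ≤ hodgeDegree d k}) := fun hK => by
    rw [hodgeFilt, ← hK.coe_equiv, LinearEquiv.finrank_map_eq]
  rw [Filt.map, f1, f2 (isHodgeDatum_one d), f2 hY.isHodgeDatum]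

theorem rankOne_planeVec (hn : 2 ≤ n) (y : Fin 2 → ℂ) : rankOne (planeVec hn y) =
    Matrix.fromBlocks 0 0
      (-Matrix.vecMulVec (inclusion hn ℂ *ᵥ y) (inclusion hn ℂ *ᵥ y)) 0 := by
  refine mat_ext fun v => ?_
  rw [rankOne_mulVec, Q_swap, Q_apply, Matrix.fromBlocks_mulVec]
  have h1 : planeVec hn y ∘ Sum.inl = 0 := rfl
  have h2 : planeVec hn y ∘ Sum.inr = inclusion hn ℂ *ᵥ y := rfl
  rw [h1, h2]
  ext (i | i)
  · simp [planeVec]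
  · simp [planeVec, Matrix.neg_mulVec, Matrix.vecMulVec_mulVec, mul_comm]

/-- Every face of `σ₀` generates a nilpotent orbit. -/
theorem exists_isNilpotentOrbit {h : HodgeNumbers n} (h_two : 2 ≤ h.h 0) (hn : 2 ≤ n) {τ : Cone n}
    (hτ : PointedCone.IsFaceOf τ (sigmaZero hn)) : ∃ F, IsNilpotentOrbit h τ F := by
  obtain ⟨d, hd0, hd⟩ := h.exists_degree h_two hn
  have hw0 : ∀ (y : Fin 2 → ℂ) i, d i ≠ 0 → (inclusion hn ℂ *ᵥ y) i = 0 := by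
    intro y i hi
    rw [Matrix.mulVec, dotProduct]
    refine Finset.sum_eq_zero fun a _ => ?_
    have : i ≠ idx hn a := fun h => hi (by rw [h, hd0])
    simp [inclusion, this]
  refine ⟨hodgeFilt d 1, ((isHodgeDatum_one d).periodDomain hd).compactDual, ?_, ?_⟩
  · obtain ⟨ℓ, κ, hgen⟩ := exists_isGenerating hn hτ
    -- The bound `0` suffices: any positive parameters give a positive semidefinite `Y`.
    refine ⟨ℓ, _, hgen, 0, fun x hx => ?_⟩
    let w : Fin ℓ → Fin n → ℂ := fun j => inclusion hn ℂ *ᵥ minVec ℂ (κ j)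
    let Y : Matrix (Fin n) (Fin n) ℂ := ∑ j, (x j : ℂ) • Matrix.vecMulVec (w j) (w j)
    have hstar : ∀ j, star (w j) = w j := by
      intro j
      ext i
      have h1 : ∀ k a, star (minVec ℂ k a) = minVec ℂ k a := by
        intro k a
        fin_cases k <;> fin_cases a <;> simp [minVec]
      simp only [w, Pi.star_apply, Matrix.mulVec, dotProduct, star_sum, star_mul', h1]
      refine Finset.sum_congr rfl fun a _ => ?_
      by_cases hi : i = idx hn a <;> simp [inclusion, hi]
    have hY : IsShear d Y := by
      refine ⟨Matrix.posSemidef_sum _ fun j _ => ?_, ?_, fun i j hij => ?_⟩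
      · have h1 := Matrix.posSemidef_vecMulVec_self_star (w j)
        rw [hstar] at h1
        exact h1.smul (by exact_mod_cast (hx j).le)
      · rw [Matrix.transpose_sum]
        refine Finset.sum_congr rfl fun j _ => ?_
        rw [Matrix.transpose_smul, Matrix.transpose_vecMulVec]
      · constructor
        · by_contra hi
          apply hij
          simp [Y, Matrix.sum_apply, Matrix.vecMulVec_apply, w, hw0 _ i hi]
        · by_contra hj
          apply hij
          simp [Y, Matrix.sum_apply, Matrix.vecMulVec_apply, w, hw0 _ j hj]
    have e : ∑ j, (Complex.I * (x j : ℂ)) • (rankOne (genVec hn ℚ (κ j))).map (algebraMap ℚ ℂ) =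
        Complex.I • Matrix.fromBlocks 0 0 (-Y) 0 := by
      have h1 : ∀ j, (rankOne (genVec hn ℚ (κ j))).map (algebraMap ℚ ℂ) =
          Matrix.fromBlocks 0 0 (-Matrix.vecMulVec (w j) (w j)) 0 := by
        intro j
        rw [rankOne_map, map_genVec, genVec, rankOne_planeVec]
      simp only [h1, mul_smul, ← Finset.smul_sum]
      congr 1
      ext (i | i) (k | k) <;> simp [Matrix.sum_apply, Y]
    rw [e, exp_eq_one_add, hY.map_hodgeFilt]
    · exact hY.isHodgeDatum.periodDomain hd
    · rw [smul_mul_smul_comm, Matrix.fromBlocks_multiply]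
      simp
  · rintro N hN p _ ⟨c, hc, rfl⟩
    obtain ⟨a, -, rfl⟩ := (mem_sigmaZero hn).1 (hτ.le hN)
    have e : toComplex (∑ k, a k • rankOne (genVec hn ℝ k)) =
        ∑ k, (a k : ℂ) • rankOne (genVec hn ℂ k) := by
      have h1 : ∀ k, rankOne (genVec hn ℂ k) = toComplex (rankOne (genVec hn ℝ k)) := by
        intro k
        rw [toComplex, rankOne_map, map_genVec]
      simp only [h1]
      ext i j
      simp [toComplex, Matrix.sum_apply]
    rw [e, Matrix.sum_mulVec]
    refine Submodule.sum_mem _ fun k _ => ?_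
    rw [Matrix.smul_mulVec, rankOne_mulVec]
    refine Submodule.smul_mem _ _ ?_
    set y : Fin n → ℂ := inclusion hn ℂ *ᵥ minVec ℂ k with hy
    rcases le_or_gt p 0 with hp | hp
    · refine Submodule.smul_mem _ _ ?_
      -- The halves cancel in the sum and differ by `i y`, which `-i` turns into `y`. The entries
      -- have degrees `0` and `-1`, so the generating vector lies in `F^{-1} ⊆ F^{p-1}`.
      refine ⟨Sum.elim ((Complex.I / 2) • y) (-((Complex.I / 2) • y)), ?_, ?_⟩
      · rintro (i | i) hk
        · rw [Sum.elim_inl, Pi.smul_apply, hy, hw0, smul_zero]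
          intro h0
          apply hk
          simp only [Set.mem_ofPred_eq, hodgeDegree, Sum.elim_inl]
          omega
        · rw [Sum.elim_inr, Pi.neg_apply, Pi.smul_apply, hy, hw0, smul_zero, neg_zero]
          intro h0
          apply hk
          simp only [Set.mem_ofPred_eq, hodgeDegree, Sum.elim_inr]
          omega
      · rw [hodgeMap_apply, genVec, planeVec, ← hy]
        ext (i | i)
        · simp
        · simp only [Sum.elim_comp_inl, Sum.elim_comp_inr, Sum.elim_inr, Pi.smul_apply, signed,
            Matrix.mul_one, Matrix.mulVec_diagonal, Pi.sub_apply, Pi.neg_apply, smul_eq_mul]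
          by_cases h0 : d i = 0
          · rw [h0, zpow_zero]
            linear_combination (-(y i)) * Complex.I_mul_I
          · rw [hy, hw0 _ i h0]
            ring
    -- For `p > 0` the entries of degrees `0` and `-1` vanish on `F^p`, so `F^p` is orthogonal to
    -- the generating vector and the rank one endomorphism kills it.
    · have hQ : Q (hodgeMap d 1 c) (genVec hn ℂ k) = 0 := by
        rw [Q_apply, genVec]
        have h1 : planeVec hn (minVec ℂ k) ∘ Sum.inl = 0 := rfl
        have h2 : planeVec hn (minVec ℂ k) ∘ Sum.inr = y := rfl
        rw [h1, h2, dotProduct_zero, zero_sub, neg_eq_zero]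
        refine Finset.sum_eq_zero fun i _ => ?_
        by_cases h0 : d i = 0
        · have e1 : c (Sum.inl i) = 0 := hc _ (by
            simp only [Set.mem_ofPred_eq, hodgeDegree, Sum.elim_inl]
            omega)
          have e2 : c (Sum.inr i) = 0 := hc _ (by
            simp only [Set.mem_ofPred_eq, hodgeDegree, Sum.elim_inr]
            omega)
          simp [hodgeMap_apply, e1, e2]
        · rw [hy, hw0 _ i h0, mul_zero]
      rw [hQ, zero_smul]
      exact Submodule.zero_mem _

/-- The translates of the faces of `σ₀` are of even type. -/
theorem isEvenTypeFan_faceTranslates {h : HodgeNumbers n} (h_two : 2 ≤ h.h 0) (hn : 2 ≤ n)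
    {A : Set (GZ n)} (hA : A.Nonempty) : IsEvenTypeFan h (faceTranslates hn A) where
  isFan := isFan_faceTranslates hn hA
  evenType := by
    rintro _ ⟨γ, hγ, τ, hτ, rfl⟩
    refine ⟨(isFan_faceTranslates hn hA).nilpotent _ ⟨γ, hγ, τ, hτ, rfl⟩, ?_, fun F hF => ?_⟩
    · obtain ⟨F, hF⟩ := exists_isNilpotentOrbit h_two hn hτ
      exact ⟨_, hF.translate γ⟩
    · exact ((isPositiveSquareZero_of_le (isPositiveSquareZero_sigmaZero hn)
        hτ.le).translate γ).isEvenTypeOrbit hF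

end Orbits

end EvenFan

theorem mainTheorem7 {n : ℕ} (h : EvenFan.HodgeNumbers n) (h_two : 2 ≤ h.h 0)
    (Γ : Subgroup (EvenFan.GZ n)) :
    let hn : 2 ≤ n := h_two.trans h.h_zero_le
    let S := EvenFan.plane hn
    -- the identification of `η(S)` with `Sym(2, ℝ)`, and of `η⁺(S)` with the positive definite cone
    Set.BijOn (EvenFan.symEquiv hn) {X | X.IsSymm} (EvenFan.eta S) ∧
    Set.BijOn (EvenFan.symEquiv hn) {X | X.PosDef} (EvenFan.etaPos S) ∧
    -- for the full group, `Σ(S)` is a polyhedral decomposition of `η⁺(S)`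
    (Γ = ⊤ → EvenFan.IsAdmissibleDecomposition Γ S (EvenFan.SigmaS hn Γ)) ∧
    -- `Σ(S)` and `Γ Σ(S)` are even-type fans
    EvenFan.IsEvenTypeFan h (EvenFan.SigmaS hn Γ) ∧
    EvenFan.IsEvenTypeFan h (EvenFan.translates Γ (EvenFan.SigmaS hn Γ)) := by
  intro hn S
  refine ⟨EvenFan.bijOn_eta hn, EvenFan.bijOn_etaPos hn, ?_, ?_, ?_⟩
  · rintro rfl
    exact EvenFan.isAdmissibleDecomposition hn
  · rw [EvenFan.sigmaS_eq]
    exact EvenFan.isEvenTypeFan_faceTranslates h_two hn ⟨1, one_mem _⟩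
  · rw [EvenFan.translates_sigmaS_eq]
    exact EvenFan.isEvenTypeFan_faceTranslates h_two hn ⟨1, one_mem _⟩
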